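/- A Hadamard space is a complete CAT(0) metric space $(X,d)$; let $X$ be one that is locally compact. Let $\partial_\infty X$ be its ideal boundary (the set of asymptote classes of geodesic rays; two rays are asymptotic if they stay at bounded distance), and give $X\cup\partial_\infty X$ the cone topology: a sequence $x_i\in X$ converges to $\xi\in\partial_\infty X$ iff, for a point $p\in X$, the segments from $p$ to $x_i$ converge, uniformly on compact sets, to the ray from $p$ in the class $\xi$. The Tits angle $\angle_T(\xi,\eta)\in[0,\pi]$ of $\xi,\eta\in\partial_\infty X$ is defined by $$\sin\frac{\angle_T(\xi,\eta)}{2}=\lim_{t\to\infty}\frac{d(c_1(t),c_2(t))}{2t},$$ where $c_1,c_2$ are the rays from a point $p\in X$ in the classes $\xi,\eta$ (the choice of $p$ does not matter), and the Tits metric $d_T$ with values in $[0,\infty]$ is the path metric induced by $\angle_T$. An isometry $g$ of $X$ is called hyperbolic if it has an axis, that is, a geodesic $c:\mathbb R\to X$ such that for some $l>0$, $g(c(t))=c(t+l)$ for all $t\in\mathbb R$. It is called rank one if it is hyperbolic and no axis $c$ of $g$ bounds a flat half plane, that is, there is no axis $c$ of $g$ and isometric embedding $f:\{(x,y)\in\mathbb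 E^2: y\ge 0\}\to X$ with $c(t)=f(t,0)$ for all $t\in\mathbb R$. Let $\Gamma$ be a group of isometries of $X$ (any subgroup of $\mathrm{Isom}(X)$), and let its limit set $\Lambda(\Gamma)\subset\partial_\infty X$ be the set of all $\xi$ for which there are $\gamma_i\in\Gamma$ and $x\in X$ with $\gamma_i(x)\to\xi$. If $\Gamma$ contains no rank one isometry, then $\Lambda(\Gamma)$ has diameter at most $2\pi$ in the Tits metric: $$d_T(\xi,\eta)\le 2\pi\qquad\text{for all }\xi,\eta\in\Lambda(\Gamma).$$ -/

import Mathlib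

open Filter Topology Set
open scoped ENNReal

namespace CatZero

/-- The Euclidean plane. -/
abbrev Plane : Type := EuclideanSpace ℝ (Fin 2)

/-- `α`, restricted to `[0, dist x y]`, is a minimal geodesic segment from `x` to `y`, parametrized
by arc length (the values of `α` elsewhere are irrelevant). -/
structure IsSegment {X : Type*} [MetricSpace X] (α : ℝ → X) (x y : X) : Prop where
  source : α 0 = x
  target : α (dist x y) = y
  isometric : ∀ s ∈ Icc (0 : ℝ) (dist x y), ∀ t ∈ Icc (0 : ℝ) (dist x y),
    dist (α s) (α t) = |s - t|

/-- Hadamard spaces, that is, complete `CAT(0)` spaces: complete metric spaces in which any two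
points are joined by a minimal geodesic and geodesic triangles are not thicker than their
comparison triangles in the Euclidean plane. In `thin`, the sides `α`, `β` of the triangle
`p, q, r` are any two sides, oriented so that they issue from their common vertex `p`, and `γ` is
the third one; the sides `α'`, `β'` of the comparison triangle `p', q', r'` correspond to `α`, `β`
by arc length. (For two points on the same side there is nothing to require.) -/
structure IsHadamardSpace (X : Type*) [MetricSpace X] : Prop where
  complete : CompleteSpace X
  geodesic : ∀ x y : X, ∃ α : ℝ → X, IsSegment α x y
  thin : ∀ (p q r : X) (α β γ : ℝ → X), IsSegment α p q → IsSegment β p r → IsSegment γ q r →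
    ∀ (p' q' r' : Plane) (α' β' : ℝ → Plane),
      dist p' q' = dist p q → dist p' r' = dist p r → dist q' r' = dist q r →
      IsSegment α' p' q' → IsSegment β' p' r' →
      ∀ s ∈ Icc (0 : ℝ) (dist p q), ∀ t ∈ Icc (0 : ℝ) (dist p r),
        dist (α s) (β t) ≤ dist (α' s) (β' t)

/-- Geodesic rays `[0, ∞) → X`. The values at negative arguments are irrelevant: they are not
seen by the relation of being asymptotic. -/
structure Ray (X : Type*) [MetricSpace X] where
  toFun : ℝ → X
  isometric : ∀ s, 0 ≤ s → ∀ t, 0 ≤ t → dist (toFun s) (toFun t) = |s - t|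

instance {X : Type*} [MetricSpace X] : CoeFun (Ray X) (fun _ => ℝ → X) := ⟨Ray.toFun⟩

/-- Two rays are asymptotic if they stay at bounded distance from each other. -/
def Asymptotic {X : Type*} [MetricSpace X] (c₁ c₂ : Ray X) : Prop :=
  ∃ K : ℝ, ∀ t, 0 ≤ t → dist (c₁ t) (c₂ t) ≤ K

instance raySetoid (X : Type*) [MetricSpace X] : Setoid (Ray X) where
  r := Asymptotic
  iseqv :=
    { refl := fun c => ⟨0, fun t _ => by simp⟩
      symm := fun ⟨K, hK⟩ => ⟨K, fun t ht => by rw [dist_comm]; exact hK t ht⟩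
      trans := fun ⟨K, hK⟩ ⟨L, hL⟩ =>
        ⟨K + L, fun t ht => (dist_triangle _ _ _).trans (add_le_add (hK t ht) (hL t ht))⟩ }

/-- The ideal boundary `∂X`: asymptote classes of rays. -/
def Boundary (X : Type*) [MetricSpace X] : Type _ := Quotient (raySetoid X)

/-- `c` is a ray from `p` in the class `ξ`. In a Hadamard space there is exactly one for any
`p` and `ξ`, up to irrelevant values. -/
def IsRayFromTo {X : Type*} [MetricSpace X] (c : Ray X) (p : X) (ξ : Boundary X) : Prop :=
  c 0 = p ∧ (Quotient.mk (raySetoid X) c : Boundary X) = ξ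

/-- `x i → ξ` in the cone topology of `X ∪ ∂X`: for a point `p` (in a Hadamard space, the choice
does not matter), the segments from `p` to `x i` have lengths tending to infinity and converge,
uniformly on compact sets, to the ray from `p` to `ξ`. -/
def ConvergesTo {X : Type*} [MetricSpace X] (x : ℕ → X) (ξ : Boundary X) : Prop :=
  ∃ (p : X) (c : Ray X) (α : ℕ → ℝ → X), IsRayFromTo c p ξ ∧ (∀ i, IsSegment (α i) p (x i)) ∧
    Tendsto (fun i => dist p (x i)) atTop atTop ∧
    ∀ R : ℝ, TendstoUniformlyOn α c atTop (Icc 0 R)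

/-- The limit set of a group of isometries: the points of `∂X` to which a sequence of points in
an orbit converges. -/
def limitSet {X : Type*} [MetricSpace X] (Γ : Subgroup (X ≃ᵢ X)) : Set (Boundary X) :=
  {ξ | ∃ g : ℕ → X ≃ᵢ X, (∀ i, g i ∈ Γ) ∧ ∃ x : X, ConvergesTo (fun i => g i x) ξ}

/-- `θ ∈ [0, π]` is the Tits angle of `ξ` and `η`: `sin (θ / 2) = lim d(c₁(t), c₂(t)) / (2 t)`
for the rays `c₁`, `c₂` from a point `p` to `ξ` and `η`. In a Hadamard space there is exactly one
such `θ`, and it does not depend on `p`. -/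
def IsTitsAngle {X : Type*} [MetricSpace X] (ξ η : Boundary X) (θ : ℝ) : Prop :=
  θ ∈ Icc 0 Real.pi ∧ ∃ (p : X) (c₁ c₂ : Ray X), IsRayFromTo c₁ p ξ ∧ IsRayFromTo c₂ p η ∧
    Tendsto (fun t : ℝ => dist (c₁ t) (c₂ t) / (2 * t)) atTop (𝓝 (Real.sin (θ / 2)))

/-- The Tits angle `∠_T(ξ, η)`, the unique `θ` with `IsTitsAngle ξ η θ` in a Hadamard space. -/
noncomputable def titsAngle {X : Type*} [MetricSpace X] (ξ η : Boundary X) : ℝ :=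
  sSup {θ | IsTitsAngle ξ η θ}

/-- Continuity of a curve in `∂X` with respect to the metric `∠_T`. -/
def TitsContinuous {X : Type*} [MetricSpace X] (τ : unitInterval → Boundary X) : Prop :=
  ∀ s : unitInterval, Tendsto (fun t : unitInterval => titsAngle (τ s) (τ t)) (𝓝 s) (𝓝 0)

/-- The length of a curve in `∂X` with respect to the metric `∠_T`: the supremum over all finite
subdivisions of the sum of the angles between consecutive points. -/
noncomputable def titsLength {X : Type*} [MetricSpace X] (τ : unitInterval → Boundary X) : ℝ≥0∞ :=
  ⨆ (n : ℕ) (u : ℕ → unitInterval) (_ : Monotone u),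
    ∑ i ∈ Finset.range n, ENNReal.ofReal (titsAngle (τ (u i)) (τ (u (i + 1))))

/-- The Tits metric: the path metric induced by `∠_T`. It is `∞` if no curve of finite length
joins the two points. -/
noncomputable def titsDist {X : Type*} [MetricSpace X] (ξ η : Boundary X) : ℝ≥0∞ :=
  ⨅ (τ : unitInterval → Boundary X) (_ : TitsContinuous τ) (_ : τ 0 = ξ) (_ : τ 1 = η), titsLength τ

/-- The diameter of a subset of `∂X` in the Tits metric. -/
noncomputable def titsDiam {X : Type*} [MetricSpace X] (S : Set (Boundary X)) : ℝ≥0∞ :=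
  ⨆ (ξ ∈ S) (η ∈ S), titsDist ξ η

/-- `c` is an axis of `g`: a complete geodesic that `g` translates by some `l > 0`. -/
def IsAxis {X : Type*} [MetricSpace X] (g : X ≃ᵢ X) (c : ℝ → X) : Prop :=
  Isometry c ∧ ∃ l : ℝ, 0 < l ∧ ∀ t, g (c t) = c (t + l)

/-- `g` is a hyperbolic isometry: it has an axis. -/
def IsHyperbolic {X : Type*} [MetricSpace X] (g : X ≃ᵢ X) : Prop :=
  ∃ c : ℝ → X, IsAxis g c

/-- `c` bounds a flat half plane: there is an isometric embedding `f` of the closed upper half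
plane with `c(t) = f(t, 0)` (the values of `f` elsewhere are irrelevant). -/
def BoundsFlatHalfPlane {X : Type*} [MetricSpace X] (c : ℝ → X) : Prop :=
  ∃ f : Plane → X, (∀ u v : Plane, 0 ≤ u 1 → 0 ≤ v 1 → dist (f u) (f v) = dist u v) ∧
    ∀ t : ℝ, c t = f !₂[t, 0]

/-- Rank one isometries: hyperbolic isometries none of whose axes bounds a flat half plane. -/
def IsRankOne {X : Type*} [MetricSpace X] (g : X ≃ᵢ X) : Prop :=
  IsHyperbolic g ∧ ∀ c : ℝ → X, IsAxis g c → ¬ BoundsFlatHalfPlane c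

end CatZero

/-! ### Geodesics, convexity and properness of Hadamard spaces. -/

namespace CatZero

/-! Two rays from `p` satisfy a dichotomy. Either they are `Joined`, by a path of rays of Tits
length at most `π`, or they are `Tight`: every segment between suitable cone neighbourhoods of their
endpoints passes within some `N` of `p` (`exists_tight`). Indeed, if tightness fails for all `N`,
there are segments with ends converging to the two ideal points that leave every ball. Seen from
`p`, a segment has total comparison angle at most `π`; parametrized by this angle, the segments
converge to a path of ideal points (`exists_angular_reparametrization`, `Conv.joined`).

Let `k i p` and `(k i)⁻¹ p` converge to two ideal points that are not joined. Ping-pong with the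
tight pair shows that some `k i` has powers with the same behaviour, so segments between far points
of its forward and backward orbits return to a fixed ball. Its displacement then attains a positive
minimum, and no axis bounds a flat half plane: `k i` is rank one (`exists_isRankOne`).

Now let `g i p → ξ`, `(g i)⁻¹ p → ξ'`, `h i p → η`, `(h i)⁻¹ p → η'`. Without rank one elements, `ξ`
is joined to `ξ'` and `η'` to `η`. If `ξ'` is joined to `η`, the path through `ξ'` has length at
most `2π`. Otherwise that pair is tight, so `g i * h i` moves `p` towards `ξ` and its inverse moves
`p` towards `η'` (`Conv.mul`). Hence `ξ` is joined to `η'`, and the path through `η'` serves. -/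

theorem plane_isSegment (x y : Plane) :
    IsSegment (fun s => x + (s / dist x y) • (y - x)) x y where
  source := by simp
  target := by
    rcases eq_or_ne (dist x y) 0 with h | h
    · rw [dist_eq_zero] at h; simp [h]
    · simp [div_self h]
  isometric := by
    intro s hs t ht
    rcases eq_or_ne (dist x y) 0 with h | h
    · rw [h] at hs ht
      have h1 : s = 0 := le_antisymm hs.2 hs.1
      have h2 : t = 0 := le_antisymm ht.2 ht.1
      simp [h1, h2]
    · rw [dist_add_left, dist_eq_norm, ← sub_smul, norm_smul, ← dist_eq_norm y x, dist_comm y x,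
        ← sub_div, Real.norm_eq_abs, abs_div, abs_of_nonneg (dist_nonneg (x := x) (y := y))]
      field_simp

namespace IsHadamardSpace

variable {X : Type*} [MetricSpace X]

/-- With `a` at the origin and `b` on the first axis, this is Stewart's identity in the comparison
triangle. All later uses of `thin` pass through this inequality. -/
theorem dist_segment_sq_le (hX : IsHadamardSpace X) {α : ℝ → X} {a b : X} (hα : IsSegment α a b)
    (p : X) {l : ℝ} (hl : l ∈ Icc (0 : ℝ) 1) :
    dist p (α (l * dist a b)) ^ 2 ≤
      (1 - l) * dist p a ^ 2 + l * dist p b ^ 2 - l * (1 - l) * dist a b ^ 2 := by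
  rcases (dist_nonneg (x := a) (y := b)).eq_or_lt with h | h
  · have hab : a = b := dist_eq_zero.1 h.symm
    rw [← h, mul_zero, hα.source, ← hab]
    nlinarith
  obtain ⟨β, hβ⟩ := hX.geodesic a p
  obtain ⟨γ, hγ⟩ := hX.geodesic b p
  set L := dist a b with hL
  set A := dist a p with hA
  set B := dist b p with hB
  have t1 : A ≤ L + B := dist_triangle a b p
  have t2 : L ≤ A + B := by rw [hB, dist_comm b p]; exact dist_triangle a p b
  have t3 : B ≤ L + A := by rw [hL, dist_comm a b]; exact dist_triangle b a p
  have hA0 : 0 ≤ A := dist_nonneg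
  have hB0 : 0 ≤ B := dist_nonneg
  set u := (L ^ 2 + A ^ 2 - B ^ 2) / (2 * L) with hu
  have hu2 : 2 * L * u = L ^ 2 + A ^ 2 - B ^ 2 := by rw [hu]; field_simp
  -- The triangle inequalities are what makes the comparison triangle exist.
  have huA : u ^ 2 ≤ A ^ 2 := by
    rw [sq_le_sq, abs_of_nonneg hA0, abs_le]
    constructor
    · by_contra hc
      push Not at hc
      nlinarith
    · by_contra hc
      push Not at hc
      nlinarith
  set v := Real.sqrt (A ^ 2 - u ^ 2) with hv
  have hv2 : v ^ 2 = A ^ 2 - u ^ 2 := Real.sq_sqrt (by linarith)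
  have d1 : dist (0 : Plane) !₂[L, 0] = L := by
    rw [EuclideanSpace.dist_eq]; simp [Fin.sum_univ_two, h.le]
  have d2 : dist (0 : Plane) !₂[u, v] = A := by
    rw [EuclideanSpace.dist_eq]
    simp only [Fin.sum_univ_two, PiLp.zero_apply, dist_zero_left, Real.norm_eq_abs, sq_abs]
    simp [hv2, Real.sqrt_sq hA0]
  have d3 : dist (!₂[L, 0] : Plane) !₂[u, v] = B := by
    rw [EuclideanSpace.dist_eq]
    simp only [Fin.sum_univ_two, Real.dist_eq, sq_abs]
    simp only [Matrix.cons_val_zero, Matrix.cons_val_one]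
    rw [show (L - u) ^ 2 + (0 - v) ^ 2 = B ^ 2 by nlinarith, Real.sqrt_sq hB0]
  have key := hX.thin a b p α β γ hα hβ hγ 0 !₂[L, 0] !₂[u, v] _ _ d1 d2 d3
    (plane_isSegment _ _) (plane_isSegment _ _) (l * L)
    ⟨mul_nonneg hl.1 h.le, by nlinarith [hl.2]⟩ A ⟨hA0, le_rfl⟩
  have e2 := (plane_isSegment 0 !₂[u, v]).target
  simp only [d2] at e2
  rw [hβ.target] at key
  simp only [d1, d2] at key
  rw [e2, mul_div_assoc, div_self h.ne', EuclideanSpace.dist_eq] at key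
  simp only [Fin.sum_univ_two, Real.dist_eq, sq_abs, PiLp.smul_apply, Matrix.cons_val_zero,
    Matrix.cons_val_one, smul_eq_mul, mul_one, sub_zero, zero_add, mul_zero] at key
  rw [dist_comm p, dist_comm p a, dist_comm p b, ← hA, ← hB]
  have k2 := pow_le_pow_left₀ dist_nonneg key 2
  rw [Real.sq_sqrt (by positivity)] at k2
  refine k2.trans (le_of_eq ?_)
  linear_combination hv2 - l * hu2

/-- The point which divides the geodesic from `x` to `y` in the ratio `l : 1 - l`. -/
noncomputable def pt (hX : IsHadamardSpace X) (x y : X) (l : ℝ) : X :=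
  (hX.geodesic x y).choose (l * dist x y)

variable (hX : IsHadamardSpace X)

theorem dist_pt_sq_le (p x y : X) {l : ℝ} (hl : l ∈ Icc (0 : ℝ) 1) :
    dist p (hX.pt x y l) ^ 2 ≤
      (1 - l) * dist p x ^ 2 + l * dist p y ^ 2 - l * (1 - l) * dist x y ^ 2 :=
  hX.dist_segment_sq_le (hX.geodesic x y).choose_spec p hl

theorem pt_mem {x y : X} {l : ℝ} (hl : l ∈ Icc (0 : ℝ) 1) :
    l * dist x y ∈ Icc (0 : ℝ) (dist x y) :=
  ⟨mul_nonneg hl.1 dist_nonneg, mul_le_of_le_one_left dist_nonneg hl.2⟩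

theorem dist_pt_pt (x y : X) {l m : ℝ} (hl : l ∈ Icc (0 : ℝ) 1) (hm : m ∈ Icc (0 : ℝ) 1) :
    dist (hX.pt x y l) (hX.pt x y m) = |l - m| * dist x y := by
  rw [pt, pt, (hX.geodesic x y).choose_spec.isometric _ (pt_mem hl) _ (pt_mem hm), ← sub_mul,
    abs_mul, abs_of_nonneg (dist_nonneg (x := x) (y := y))]

@[simp] theorem pt_zero (x y : X) : hX.pt x y 0 = x := by
  rw [pt, zero_mul]; exact (hX.geodesic x y).choose_spec.source

@[simp] theorem pt_one (x y : X) : hX.pt x y 1 = y := by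
  rw [pt, one_mul]; exact (hX.geodesic x y).choose_spec.target

theorem dist_left_pt (x y : X) {l : ℝ} (hl : l ∈ Icc (0 : ℝ) 1) :
    dist x (hX.pt x y l) = l * dist x y := by
  have := hX.dist_pt_pt x y (l := 0) ⟨le_rfl, zero_le_one⟩ hl
  rwa [pt_zero, zero_sub, abs_neg, abs_of_nonneg hl.1] at this

theorem dist_pt_right (x y : X) {l : ℝ} (hl : l ∈ Icc (0 : ℝ) 1) :
    dist (hX.pt x y l) y = (1 - l) * dist x y := by
  have := hX.dist_pt_pt x y (m := 1) hl ⟨zero_le_one, le_rfl⟩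
  rwa [pt_one, abs_sub_comm, abs_of_nonneg (sub_nonneg.2 hl.2)] at this

/-- Uniqueness of geodesics: the convexity inequality at `z` has right side at most zero, since `(1
- l) l² + l (1 - l)² = l (1 - l)`. -/
theorem eq_pt {x y z : X} {l : ℝ} (hl : l ∈ Icc (0 : ℝ) 1) (h₁ : dist x z ≤ l * dist x y)
    (h₂ : dist z y ≤ (1 - l) * dist x y) : z = hX.pt x y l := by
  have h := hX.dist_pt_sq_le z x y hl
  rw [dist_comm z x] at h
  have e1 := pow_le_pow_left₀ dist_nonneg h₁ 2
  have e2 := pow_le_pow_left₀ dist_nonneg h₂ 2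
  have hl' : 0 ≤ 1 - l := sub_nonneg.2 hl.2
  have : dist z (hX.pt x y l) ^ 2 ≤ 0 := by
    have := mul_le_mul_of_nonneg_left e1 hl'
    have := mul_le_mul_of_nonneg_left e2 hl.1
    nlinarith
  exact dist_eq_zero.1 (pow_eq_zero_iff two_ne_zero |>.1 (le_antisymm this (sq_nonneg _)))

theorem pt_symm (x y : X) {l : ℝ} (hl : l ∈ Icc (0 : ℝ) 1) :
    hX.pt x y l = hX.pt y x (1 - l) := by
  have hl' : 1 - l ∈ Icc (0 : ℝ) 1 := ⟨sub_nonneg.2 hl.2, by linarith [hl.1]⟩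
  refine hX.eq_pt hl' ?_ ?_
  · rw [dist_comm, hX.dist_pt_right x y hl, dist_comm x y]
  · rw [dist_comm, hX.dist_left_pt x y hl, dist_comm x y]; linarith

theorem map_pt (g : X ≃ᵢ X) (x y : X) {l : ℝ} (hl : l ∈ Icc (0 : ℝ) 1) :
    g (hX.pt x y l) = hX.pt (g x) (g y) l := by
  refine hX.eq_pt hl ?_ ?_
  · rw [g.dist_eq, g.dist_eq, hX.dist_left_pt x y hl]
  · rw [g.dist_eq, g.dist_eq, hX.dist_pt_right x y hl]

theorem pt_pt (p x : X) {l m : ℝ} (hl : l ∈ Icc (0 : ℝ) 1) (hm : m ∈ Icc (0 : ℝ) 1) :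
    hX.pt p (hX.pt p x l) m = hX.pt p x (m * l) := by
  have hml : m * l ∈ Icc (0 : ℝ) 1 := ⟨mul_nonneg hm.1 hl.1, mul_le_one₀ hm.2 hl.1 hl.2⟩
  refine (hX.eq_pt hm ?_ ?_).symm
  · rw [hX.dist_left_pt p x hml, hX.dist_left_pt p x hl, mul_assoc]
  · rw [hX.dist_left_pt p x hl, hX.dist_pt_pt p x hml hl, abs_sub_comm,
      abs_of_nonneg (by nlinarith [hl.1, hm.2])]
    linarith

/-- Comparison of a triangle with a smaller one with the same vertex. -/
theorem angle_mono (p x y : X) {l m : ℝ} (hl : l ∈ Icc (0 : ℝ) 1) (hm : m ∈ Icc (0 : ℝ) 1) :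
    dist (hX.pt p x l) (hX.pt p y m) ^ 2 ≤ (l * dist p x) ^ 2 + (m * dist p y) ^ 2 -
      l * m * (dist p x ^ 2 + dist p y ^ 2 - dist x y ^ 2) := by
  have h1 := hX.dist_pt_sq_le (hX.pt p x l) p y hm
  have h2 := hX.dist_pt_sq_le y p x hl
  rw [dist_comm _ p, hX.dist_left_pt p x hl, dist_comm _ y] at h1
  rw [dist_comm y p, dist_comm y x] at h2
  have := mul_le_mul_of_nonneg_left h2 hm.1
  nlinarith

theorem dist_pt_same_left (p x y : X) {l : ℝ} (hl : l ∈ Icc (0 : ℝ) 1) :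
    dist (hX.pt p x l) (hX.pt p y l) ≤ l * dist x y := by
  refine abs_le_of_sq_le_sq' ?_ (mul_nonneg hl.1 dist_nonneg) |>.2
  have := hX.angle_mono p x y hl hl
  linarith

/-- Convexity of the metric: cut the quadrilateral along the diagonal from `x` to `y'`. -/
theorem dist_pt_pt_le (x y x' y' : X) {l : ℝ} (hl : l ∈ Icc (0 : ℝ) 1) :
    dist (hX.pt x y l) (hX.pt x' y' l) ≤ (1 - l) * dist x x' + l * dist y y' := by
  have hl' : 1 - l ∈ Icc (0 : ℝ) 1 := ⟨sub_nonneg.2 hl.2, by linarith [hl.1]⟩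
  have h1 := hX.dist_pt_same_left x y y' hl
  have h2 := hX.dist_pt_same_left y' x x' hl'
  rw [← hX.pt_symm x y' hl, ← hX.pt_symm x' y' hl] at h2
  linarith [dist_triangle (hX.pt x y l) (hX.pt x y' l) (hX.pt x' y' l)]

/-- The point at distance `t` from `p` on the geodesic from `p` to `x`. -/
noncomputable def geo (p x : X) (t : ℝ) : X := hX.pt p x (t / dist p x)

theorem div_mem {t d : ℝ} (h0 : 0 ≤ t) (h : t ≤ d) : t / d ∈ Icc (0 : ℝ) 1 :=
  ⟨div_nonneg h0 (h0.trans h), div_le_one_of_le₀ h (h0.trans h)⟩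

theorem div_mul_self {t d : ℝ} (h0 : 0 ≤ t) (h : t ≤ d) : t / d * d = t := by
  rcases eq_or_ne d 0 with rfl | hd
  · simp [le_antisymm h h0]
  · field_simp

@[simp] theorem geo_zero (p x : X) : hX.geo p x 0 = p := by simp [geo]

@[simp] theorem geo_dist (p x : X) : hX.geo p x (dist p x) = x := by
  rw [geo]
  rcases eq_or_ne (dist p x) 0 with h0 | h0
  · rw [h0]; simpa using dist_eq_zero.1 h0
  · rw [div_self h0, pt_one]

theorem dist_geo_geo (p x : X) {s t : ℝ} (hs : 0 ≤ s) (hs' : s ≤ dist p x) (ht : 0 ≤ t)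
    (ht' : t ≤ dist p x) : dist (hX.geo p x s) (hX.geo p x t) = |s - t| := by
  rw [geo, geo, hX.dist_pt_pt p x (div_mem hs hs') (div_mem ht ht')]
  conv_lhs => rw [← abs_of_nonneg (dist_nonneg (x := p) (y := x)), ← abs_mul, sub_mul,
    abs_of_nonneg (dist_nonneg (x := p) (y := x)), div_mul_self hs hs', div_mul_self ht ht']

theorem dist_left_geo (p x : X) {t : ℝ} (ht : 0 ≤ t) (ht' : t ≤ dist p x) :
    dist p (hX.geo p x t) = t := by
  have := hX.dist_geo_geo p x le_rfl dist_nonneg ht ht'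
  rwa [geo_zero, zero_sub, abs_neg, abs_of_nonneg ht] at this

theorem segment_eq_geo {α : ℝ → X} {x y : X} (hα : IsSegment α x y) {t : ℝ} (ht : 0 ≤ t)
    (ht' : t ≤ dist x y) : α t = hX.geo x y t := by
  refine hX.eq_pt (div_mem ht ht') ?_ ?_
  · rw [div_mul_self ht ht', ← hα.source,
      hα.isometric 0 ⟨le_rfl, dist_nonneg⟩ t ⟨ht, ht'⟩, zero_sub, abs_neg, abs_of_nonneg ht]
  · rw [sub_mul, one_mul, div_mul_self ht ht']
    conv_lhs => rw [← hα.target]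
    rw [hα.isometric t ⟨ht, ht'⟩ _ ⟨dist_nonneg, le_rfl⟩, abs_sub_comm,
      abs_of_nonneg (sub_nonneg.2 ht')]

theorem geo_pt (p x : X) {l t : ℝ} (hl : l ∈ Icc (0 : ℝ) 1) (ht : 0 ≤ t)
    (ht' : t ≤ dist p (hX.pt p x l)) : hX.geo p (hX.pt p x l) t = hX.geo p x t := by
  rw [geo, hX.pt_pt p x hl (div_mem ht ht'), hX.dist_left_pt p x hl, geo]
  congr 1
  rcases eq_or_ne l 0 with rfl | h
  · rw [pt_zero, dist_self] at ht'
    simp [le_antisymm ht' ht]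
  · rw [div_mul_eq_mul_div, mul_comm t, mul_div_mul_left _ _ h]

/-- Convexity controls points in equal ratio; passing from equal ratio to equal arc length costs the
factor `2`. -/
theorem dist_geo_geo_le (p q x y : X) {t : ℝ} (ht : 0 ≤ t) (hx : t ≤ dist p x)
    (hy : t ≤ dist q y) :
    dist (hX.geo p x t) (hX.geo q y t) ≤ 2 * (dist p q + dist x y) := by
  have hl := div_mem ht hx
  have h1 := hX.dist_pt_pt_le p x q y hl
  have h2 := hX.dist_pt_pt q y hl (div_mem ht hy)
  rw [← abs_of_nonneg (dist_nonneg (x := q) (y := y)), ← abs_mul, sub_mul,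
    abs_of_nonneg (dist_nonneg (x := q) (y := y)), div_mul_self ht hy] at h2
  have h3 : |t / dist p x * dist q y - t| ≤ dist p q + dist x y := by
    have e : t / dist p x * dist q y - t = t / dist p x * (dist q y - dist p x) := by
      rw [mul_sub, div_mul_self ht hx]
    rw [e, abs_mul, abs_of_nonneg hl.1]
    have : |dist q y - dist p x| ≤ dist p q + dist x y := by
      rw [← Real.dist_eq, dist_comm p q, dist_comm x y]; exact dist_dist_dist_le _ _ _ _
    exact (mul_le_of_le_one_left (abs_nonneg _) hl.2).trans this
  have h4 := dist_triangle (hX.geo p x t) (hX.pt q y (t / dist p x)) (hX.geo q y t)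
  rw [geo, geo] at *
  nlinarith [hl.1, hl.2, dist_nonneg (x := p) (y := q), dist_nonneg (x := x) (y := y)]

theorem dist_geo_le_div (p x y : X) {t : ℝ} (ht : 0 ≤ t) (hx : t ≤ dist p x)
    (hy : t ≤ dist p y) :
    dist (hX.geo p x t) (hX.geo p y t) ≤ 2 * t * dist x y / dist p x := by
  have hl := div_mem ht hx
  have h1 := hX.dist_pt_same_left p x y hl
  have h2 := hX.dist_pt_pt p y hl (div_mem ht hy)
  rw [← abs_of_nonneg (dist_nonneg (x := p) (y := y)), ← abs_mul, sub_mul,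
    abs_of_nonneg (dist_nonneg (x := p) (y := y)), div_mul_self ht hy] at h2
  have h3 : |t / dist p x * dist p y - t| ≤ t / dist p x * dist x y := by
    have e : t / dist p x * dist p y - t = t / dist p x * (dist p y - dist p x) := by
      rw [mul_sub, div_mul_self ht hx]
    rw [e, abs_mul, abs_of_nonneg hl.1]
    refine mul_le_mul_of_nonneg_left ?_ hl.1
    rw [dist_comm p y, dist_comm p x, dist_comm x y]
    exact abs_dist_sub_le _ _ _
  have h4 := dist_triangle (hX.geo p x t) (hX.pt p y (t / dist p x)) (hX.geo p y t)
  have e : 2 * t * dist x y / dist p x = 2 * (t / dist p x * dist x y) := by ring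
  rw [e]
  rw [geo, geo] at *
  linarith

/-- Monotonicity of comparison angles: a bound `θ` at `p` for the far points holds for nearer points
on the same segments. -/
theorem angle_mono_geo (p x y : X) {s t : ℝ} (hs : 0 ≤ s) (hx : s ≤ dist p x) (ht : 0 ≤ t)
    (hy : t ≤ dist p y) {θ : ℝ}
    (hθ : dist x y ^ 2 ≤ dist p x ^ 2 + dist p y ^ 2 - 2 * dist p x * dist p y * Real.cos θ) :
    dist (hX.geo p x s) (hX.geo p y t) ^ 2 ≤ s ^ 2 + t ^ 2 - 2 * s * t * Real.cos θ := by
  have hl := div_mem hs hx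
  have hm := div_mem ht hy
  have h := hX.angle_mono p x y hl hm
  have k := mul_le_mul_of_nonneg_left hθ (mul_nonneg hl.1 hm.1)
  have e : s / dist p x * (t / dist p y) *
      (dist p x ^ 2 + dist p y ^ 2 - 2 * dist p x * dist p y * Real.cos θ) =
      s / dist p x * (t / dist p y) * (dist p x ^ 2 + dist p y ^ 2) -
      2 * (s / dist p x * dist p x) * (t / dist p y * dist p y) * Real.cos θ := by ring
  rw [e] at k
  rw [div_mul_self hs hx, div_mul_self ht hy] at h k
  rw [geo, geo]
  nlinarith

/-- The Hopf–Rinow theorem for Hadamard spaces. -/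
theorem properSpace [LocallyCompactSpace X] (hX : IsHadamardSpace X) : ProperSpace X := by
  have := hX.complete
  rcases isEmpty_or_nonempty X with hE | ⟨⟨p⟩⟩
  · exact ⟨fun x => hE.elim x⟩
  -- The radii of compact balls form an open and closed set: `step` enlarges such a radius, `lim`
  -- passes to a supremum.
  have step : ∀ r : ℝ, 0 ≤ r → IsCompact (Metric.closedBall p r) →
      ∃ δ > 0, IsCompact (Metric.closedBall p (r + δ)) := by
    intro r hr hc
    obtain ⟨δ, hδ, hδc⟩ := hc.exists_isCompact_cthickening
    refine ⟨δ, hδ, hδc.of_isClosed_subset Metric.isClosed_closedBall fun x hx => ?_⟩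
    rw [Metric.mem_closedBall, dist_comm] at hx
    rcases le_total (dist p x) r with h | h
    · exact Metric.self_subset_cthickening _ (by rwa [Metric.mem_closedBall, dist_comm])
    · refine Metric.mem_cthickening_of_dist_le x (hX.geo p x r) _ _ ?_ ?_
      · rw [Metric.mem_closedBall, dist_comm, hX.dist_left_geo p x hr h]
      · have := hX.dist_geo_geo p x dist_nonneg le_rfl hr h
        rw [geo_dist, abs_of_nonneg (sub_nonneg.2 h)] at this
        linarith
  have lim : ∀ r : ℝ, 0 < r → (∀ s, 0 ≤ s → s < r → IsCompact (Metric.closedBall p s)) →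
      IsCompact (Metric.closedBall p r) := by
    intro r hr hs
    refine TotallyBounded.isCompact_of_isClosed ?_ Metric.isClosed_closedBall
    rw [Metric.totallyBounded_iff]
    intro ε hε
    -- Shrinking towards `p` moves the `r`-ball by at most `δ` into the compact ball of radius `r -
    -- δ`.
    set δ := min (ε / 2) (r / 2) with hδ
    have hδ0 : 0 < δ := lt_min (by linarith) (by linarith)
    have hδε : δ ≤ ε / 2 := min_le_left _ _
    have hδr : δ ≤ r / 2 := min_le_right _ _
    obtain ⟨F, hF, hcov⟩ := Metric.totallyBounded_iff.1
      (hs (r - δ) (by linarith) (by linarith)).totallyBounded (ε / 2) (by linarith)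
    refine ⟨F, hF, fun x hx => ?_⟩
    rw [Metric.mem_closedBall, dist_comm] at hx
    have hl : 1 - δ / r ∈ Icc (0 : ℝ) 1 := by
      have := div_mem hδ0.le (show δ ≤ r by linarith)
      exact ⟨by linarith [this.2], by linarith [this.1]⟩
    have hy : hX.pt p x (1 - δ / r) ∈ Metric.closedBall p (r - δ) := by
      rw [Metric.mem_closedBall, dist_comm, hX.dist_left_pt p x hl]
      refine (mul_le_mul_of_nonneg_left hx hl.1).trans (le_of_eq ?_)
      field_simp
    obtain ⟨z, hz, hyz⟩ := mem_iUnion₂.1 (hcov hy)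
    refine mem_iUnion₂.2 ⟨z, hz, ?_⟩
    rw [Metric.mem_ball] at hyz ⊢
    have h1 : dist (hX.pt p x (1 - δ / r)) x ≤ δ := by
      rw [hX.dist_pt_right p x hl, sub_sub_cancel]
      refine (mul_le_mul_of_nonneg_left hx (by positivity)).trans (le_of_eq ?_)
      field_simp
    rw [dist_comm] at h1
    linarith [dist_triangle x (hX.pt p x (1 - δ / r)) z]
  have all : ∀ r : ℝ, 0 ≤ r → IsCompact (Metric.closedBall p r) := by
    by_contra hne
    push Not at hne
    set S := {r : ℝ | 0 ≤ r ∧ ¬ IsCompact (Metric.closedBall p r)} with hS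
    have hSne : S.Nonempty := hne
    have hSb : BddBelow S := ⟨0, fun r hr => hr.1⟩
    have h0 : 0 ≤ sInf S := le_csInf hSne fun r hr => hr.1
    have hlt : ∀ s, 0 ≤ s → s < sInf S → IsCompact (Metric.closedBall p s) := by
      intro s hs hsS
      by_contra hc
      exact absurd (csInf_le hSb ⟨hs, hc⟩) (not_le.2 hsS)
    have hc : IsCompact (Metric.closedBall p (sInf S)) := by
      rcases h0.eq_or_lt with h | h
      · rw [← h, Metric.closedBall_zero]; exact isCompact_singleton
      · exact lim _ h hlt
    obtain ⟨δ, hδ, hδc⟩ := step _ h0 hc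
    obtain ⟨r, hr, hrlt⟩ := exists_lt_of_csInf_lt hSne (show sInf S < sInf S + δ by linarith)
    exact hr.2 (hδc.of_isClosed_subset Metric.isClosed_closedBall
      (Metric.closedBall_subset_closedBall hrlt.le))
  refine ProperSpace.of_isCompact_closedBall_of_le 0 fun x r hr =>
    (all (r + dist x p) (by positivity)).of_isClosed_subset Metric.isClosed_closedBall
      (Metric.closedBall_subset_closedBall' le_rfl)

end IsHadamardSpace

end CatZero

/-! ### Convergence to ideal points along a filter. -/

namespace CatZero

variable {X : Type*} [MetricSpace X]

theorem asymptotic_of_mk_eq {c c' : Ray X}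
    (h : (Quotient.mk (raySetoid X) c : Boundary X) = Quotient.mk (raySetoid X) c') :
    Asymptotic c c' := Quotient.exact h

namespace IsHadamardSpace

variable (hX : IsHadamardSpace X)

/-- The points `x i` converge to the endpoint of the ray `c` from `p`, along the filter `ω`. -/
structure Conv (ω : Filter ℕ) (p : X) (x : ℕ → X) (c : Ray X) : Prop where
  dist_tendsto : Tendsto (fun i => dist p (x i)) ω atTop
  geo_tendsto : ∀ t, 0 ≤ t → Tendsto (fun i => hX.geo p (x i) t) ω (𝓝 (c t))

variable {hX}

theorem Conv.source {ω : Filter ℕ} [ω.NeBot] {p : X} {x : ℕ → X} {c : Ray X}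
    (h : hX.Conv ω p x c) : c 0 = p := by
  have := h.geo_tendsto 0 le_rfl
  simp only [geo_zero] at this
  exact tendsto_nhds_unique this tendsto_const_nhds

/-- Points running to infinity converge to some ideal point along an ultrafilter. -/
theorem exists_conv [ProperSpace X] (hX : IsHadamardSpace X) (ω : Ultrafilter ℕ) (p : X)
    (x : ℕ → X) (h : Tendsto (fun i => dist p (x i)) ω atTop) :
    ∃ c : Ray X, hX.Conv ω p x c := by
  have lim : ∀ t : ℝ, ∃ y : X, 0 ≤ t → Tendsto (fun i => hX.geo p (x i) t) ω (𝓝 y) := by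
    intro t
    by_cases ht : 0 ≤ t
    · have hmem : ∀ᶠ i in (ω : Filter ℕ), hX.geo p (x i) t ∈ Metric.closedBall p t := by
        filter_upwards [h.eventually_ge_atTop t] with i hi
        rw [Metric.mem_closedBall, dist_comm, hX.dist_left_geo p (x i) ht hi]
      obtain ⟨y, -, hy⟩ := (isCompact_closedBall p t).ultrafilter_le_nhds
        (ω.map fun i => hX.geo p (x i) t) (le_principal_iff.2 hmem)
      exact ⟨y, fun _ => hy⟩
    · exact ⟨p, fun h => absurd h ht⟩
  choose c hc using lim
  refine ⟨⟨c, fun s hs t ht => ?_⟩, h, hc⟩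
  refine tendsto_nhds_unique ((hc s hs).dist (hc t ht)) (tendsto_const_nhds.congr' ?_)
  filter_upwards [h.eventually_ge_atTop s, h.eventually_ge_atTop t] with i hi hi'
  rw [hX.dist_geo_geo p (x i) hs hi ht hi']

/-- The segment from `p` to `y i` passes within `R` of `x i`. As `x i` is far away, the initial
pieces of the segments to `x i` and `y i` have the same limit. -/
theorem Conv.of_dist_le {ω : Filter ℕ} {p : X} {x y : ℕ → X} {c : Ray X}
    (h : hX.Conv ω p x c) {R : ℝ} {l : ℕ → ℝ} (hl : ∀ᶠ i in ω, l i ∈ Icc (0 : ℝ) 1)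
    (hR : ∀ᶠ i in ω, dist (x i) (hX.pt p (y i) (l i)) ≤ R) : hX.Conv ω p y c := by
  have hz : Tendsto (fun i => dist p (hX.pt p (y i) (l i))) ω atTop := by
    refine tendsto_atTop_mono' ω ?_ (tendsto_atTop_add_const_right ω (-R) h.dist_tendsto)
    filter_upwards [hR] with i hi
    have := dist_triangle_right p (x i) (hX.pt p (y i) (l i))
    linarith
  have hle : ∀ᶠ i in ω, dist p (hX.pt p (y i) (l i)) ≤ dist p (y i) := by
    filter_upwards [hl] with i hi
    rw [hX.dist_left_pt p (y i) hi]
    exact mul_le_of_le_one_left dist_nonneg hi.2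
  refine ⟨tendsto_atTop_mono' ω hle hz, fun t ht => ?_⟩
  have h0 : Tendsto (fun i => 2 * t * R / dist p (x i)) ω (𝓝 0) :=
    tendsto_const_nhds.div_atTop h.dist_tendsto
  have h1 : Tendsto (fun i => dist (hX.geo p (x i) t) (hX.geo p (y i) t)) ω (𝓝 0) := by
    refine squeeze_zero' (Eventually.of_forall fun i => dist_nonneg) ?_ h0
    filter_upwards [hl, hR, hz.eventually_ge_atTop t, h.dist_tendsto.eventually_ge_atTop t]
      with i hi hiR hzi hxi
    rw [← hX.geo_pt p (y i) hi ht hzi]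
    refine (hX.dist_geo_le_div p (x i) _ ht hxi hzi).trans ?_
    gcongr
  exact (tendsto_iff_of_dist h1).1 (h.geo_tendsto t ht)

/-- Convergence in the cone topology does not depend on the base point and is not affected by
bounded perturbations. -/
theorem exists_conv_of_convergesTo [ProperSpace X] (hX : IsHadamardSpace X) (ω : Ultrafilter ℕ)
    (hω : (ω : Filter ℕ) ≤ atTop) {x y : ℕ → X} {ξ : Boundary X} (hx : ConvergesTo x ξ) (p : X)
    {K : ℝ} (hK : ∀ i, dist (y i) (x i) ≤ K) :
    ∃ c : Ray X, hX.Conv ω p y c ∧ IsRayFromTo c p ξ := by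
  obtain ⟨q, c', α, hc', hα, hd, hu⟩ := hx
  have hd' := hd.mono_left hω
  have hy : Tendsto (fun i => dist p (y i)) ω atTop := by
    refine tendsto_atTop_mono (fun i => ?_)
      (tendsto_atTop_add_const_right (ω : Filter ℕ) (-(dist p q + K)) hd')
    have h1 := dist_triangle q p (x i)
    have h2 := dist_triangle p (y i) (x i)
    have h3 := hK i
    rw [dist_comm q p] at h1
    linarith
  obtain ⟨c, hc⟩ := hX.exists_conv ω p y hy
  refine ⟨c, hc, hc.source, ?_⟩
  rw [← hc'.2]
  refine Quotient.sound ⟨2 * (dist p q + K), fun t ht => ?_⟩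
  have h1 : Tendsto (fun i => α i t) ω (𝓝 (c' t)) :=
    ((hu t).tendsto_at ⟨ht, le_rfl⟩).mono_left hω
  refine le_of_tendsto ((hc.geo_tendsto t ht).dist h1) ?_
  filter_upwards [hy.eventually_ge_atTop t, hd'.eventually_ge_atTop t] with i hi hi'
  rw [hX.segment_eq_geo (hα i) ht hi']
  refine (hX.dist_geo_geo_le p q (y i) (x i) ht hi hi').trans ?_
  linarith [hK i]

end IsHadamardSpace

end CatZero

/-! ### Comparison angles of rays and Tits length. -/

namespace CatZero

variable {X : Type*} [MetricSpace X]

/-- All comparison angles of the pair of rays `c`, `c'` are at most `θ`. -/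
def AngLE (c c' : Ray X) (θ : ℝ) : Prop :=
  ∀ s, 0 ≤ s → ∀ t, 0 ≤ t → dist (c s) (c' t) ^ 2 ≤ s ^ 2 + t ^ 2 - 2 * s * t * Real.cos θ

theorem AngLE.symm {c c' : Ray X} {θ : ℝ} (h : AngLE c c' θ) : AngLE c' c θ := by
  intro s hs t ht
  rw [dist_comm]
  linarith [h t ht s hs]

theorem AngLE.congr {c₁ c₂ d₁ d₂ : Ray X} {θ : ℝ} (h : AngLE c₁ c₂ θ)
    (h₁ : ∀ t, 0 ≤ t → c₁ t = d₁ t) (h₂ : ∀ t, 0 ≤ t → c₂ t = d₂ t) : AngLE d₁ d₂ θ := by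
  intro s hs t ht
  rw [← h₁ s hs, ← h₂ t ht]
  exact h s hs t ht

theorem AngLE.eq_of_zero {c c' : Ray X} (h : AngLE c c' 0) {t : ℝ} (ht : 0 ≤ t) :
    c t = c' t := by
  have := h t ht t ht
  rw [Real.cos_zero] at this
  exact dist_eq_zero.1 (pow_eq_zero_iff two_ne_zero |>.1
    (le_antisymm (by linarith) (sq_nonneg _)))

theorem AngLE.source_eq {c c' : Ray X} {θ : ℝ} (h : AngLE c c' θ) : c 0 = c' 0 := by
  have := h 0 le_rfl 0 le_rfl
  exact dist_eq_zero.1 (pow_eq_zero_iff two_ne_zero |>.1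
    (le_antisymm (by linarith) (sq_nonneg _)))

/-- Lay two planar sectors of angles `α` and `β` side by side. The chord between the outer points
crosses the middle ray, and the triangle inequality through the corresponding point of `c₂` gives
the bound. -/
theorem AngLE.trans {c₁ c₂ c₃ : Ray X} {α β : ℝ} (h₁ : AngLE c₁ c₂ α) (h₂ : AngLE c₂ c₃ β)
    (hα : 0 ≤ α) (hβ : 0 ≤ β) (hαβ : α + β ≤ Real.pi) : AngLE c₁ c₃ (α + β) := by
  rcases hα.eq_or_lt with rfl | hα
  · rw [zero_add]
    exact h₂.congr (fun t ht => (h₁.eq_of_zero ht).symm) fun _ _ => rfl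
  rcases hβ.eq_or_lt with rfl | hβ
  · rw [add_zero]
    exact h₁.congr (fun _ _ => rfl) fun t ht => h₂.eq_of_zero ht
  intro s hs t ht
  have sα : 0 < Real.sin α := Real.sin_pos_of_pos_of_lt_pi hα (by linarith)
  have sβ : 0 < Real.sin β := Real.sin_pos_of_pos_of_lt_pi hβ (by linarith)
  set D := s * Real.sin α + t * Real.sin β with hD
  have h1 : 0 ≤ s * Real.sin α := mul_nonneg hs sα.le
  have h2 : 0 ≤ t * Real.sin β := mul_nonneg ht sβ.le
  rcases (show 0 ≤ D by positivity).eq_or_lt with hD0 | hD0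
  · have s0 : s = 0 := by
      have : s * Real.sin α = 0 := by linarith
      exact (mul_eq_zero.1 this).resolve_right sα.ne'
    have t0 : t = 0 := by
      have : t * Real.sin β = 0 := by linarith
      exact (mul_eq_zero.1 this).resolve_right sβ.ne'
    subst s0 t0
    rw [h₁.source_eq, h₂.source_eq]
    simp
  -- The outer points have heights `s sin α` and `t sin β` on opposite sides of the middle ray, so
  -- the chord, of length `√Q`, crosses it in ratio `μ`, at abscissa `r`; `r ≥ 0` because `α + β ≤
  -- π`.
  set μ := s * Real.sin α / D with hμ
  have hμD : μ * D = s * Real.sin α := by rw [hμ]; field_simp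
  have hμ0 : 0 ≤ μ := div_nonneg h1 hD0.le
  have hμ1 : μ ≤ 1 := div_le_one_of_le₀ (by linarith) hD0.le
  set r := (1 - μ) * (s * Real.cos α) + μ * (t * Real.cos β) with hr
  have hrD : r * D = s * t * Real.sin (α + β) := by
    rw [Real.sin_add, hr]
    linear_combination (t * Real.cos β - s * Real.cos α) * hμD + s * Real.cos α * hD
  have hr0 : 0 ≤ r := by
    by_contra hc
    push Not at hc
    have : 0 ≤ Real.sin (α + β) := Real.sin_nonneg_of_nonneg_of_le_pi (by linarith) hαβ
    have : 0 ≤ s * t * Real.sin (α + β) := by positivity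
    nlinarith
  set Q := s ^ 2 + t ^ 2 - 2 * s * t * Real.cos (α + β) with hQ
  have hQ' : Q = (s * Real.cos α - t * Real.cos β) ^ 2 + D ^ 2 := by
    rw [hQ, Real.cos_add, hD]
    linear_combination (-s ^ 2) * Real.sin_sq_add_cos_sq α - t ^ 2 * Real.sin_sq_add_cos_sq β
  have hQ0 : 0 ≤ Q := by rw [hQ']; positivity
  have e1 : s ^ 2 + r ^ 2 - 2 * s * r * Real.cos α = (μ * √Q) ^ 2 := by
    rw [mul_pow, Real.sq_sqrt hQ0, hQ']
    have : μ ^ 2 * D ^ 2 = (s * Real.sin α) ^ 2 := by rw [← hμD]; ring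
    rw [hr]
    linear_combination -this - s ^ 2 * Real.sin_sq_add_cos_sq α
  have e2 : r ^ 2 + t ^ 2 - 2 * r * t * Real.cos β = ((1 - μ) * √Q) ^ 2 := by
    rw [mul_pow, Real.sq_sqrt hQ0, hQ']
    have : (1 - μ) ^ 2 * D ^ 2 = (t * Real.sin β) ^ 2 := by
      rw [← mul_pow, sub_mul, hμD, hD]; ring
    rw [hr]
    linear_combination -this - t ^ 2 * Real.sin_sq_add_cos_sq β
  have d1 : dist (c₁ s) (c₂ r) ≤ μ * √Q :=
    le_of_sq_le_sq ((h₁ s hs r hr0).trans e1.le) (by positivity)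
  have d2 : dist (c₂ r) (c₃ t) ≤ (1 - μ) * √Q :=
    le_of_sq_le_sq ((h₂ r hr0 t ht).trans e2.le)
      (mul_nonneg (sub_nonneg.2 hμ1) (Real.sqrt_nonneg _))
  rw [← Real.sq_sqrt hQ0]
  refine pow_le_pow_left₀ dist_nonneg ?_ 2
  linarith [dist_triangle (c₁ s) (c₂ r) (c₃ t)]

theorem one_sub_cos_eq (θ : ℝ) : 1 - Real.cos θ = 2 * Real.sin (θ / 2) ^ 2 := by
  have h := Real.cos_two_mul (θ / 2)
  have h' := Real.sin_sq_add_cos_sq (θ / 2)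
  rw [mul_div_cancel₀ θ two_ne_zero] at h
  linarith

theorem titsAngle_nonneg (ξ η : Boundary X) : 0 ≤ titsAngle ξ η :=
  Real.sSup_nonneg fun _ h => h.1.1

theorem titsAngle_le_pi (ξ η : Boundary X) : titsAngle ξ η ≤ Real.pi :=
  Real.sSup_le (fun _ h => h.1.2) Real.pi_pos.le

/-- Replacing the rays by asymptotic ones changes distances by a bounded amount, which vanishes
after division by `2 * t`. Each admissible angle is bounded; `h0` also covers an empty supremum,
whose value is `0`. -/
theorem titsAngle_le {c c' : Ray X} {θ : ℝ} (h : AngLE c c' θ) (h0 : 0 ≤ θ)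
    (hπ : θ ≤ Real.pi) :
    titsAngle (Quotient.mk (raySetoid X) c : Boundary X) (Quotient.mk (raySetoid X) c') ≤ θ := by
  refine Real.sSup_le ?_ h0
  rintro φ ⟨⟨hφ0, hφπ⟩, p, d, d', hd, hd', hlim⟩
  obtain ⟨K, hK⟩ := asymptotic_of_mk_eq hd.2
  obtain ⟨K', hK'⟩ := asymptotic_of_mk_eq hd'.2
  have s0 : 0 ≤ Real.sin (θ / 2) := Real.sin_nonneg_of_nonneg_of_le_pi (by linarith) (by linarith)
  have bound : ∀ᶠ t : ℝ in atTop,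
      dist (d t) (d' t) / (2 * t) ≤ Real.sin (θ / 2) + (K + K') / 2 / t := by
    filter_upwards [eventually_gt_atTop 0] with t ht
    have h1 : dist (c t) (c' t) ≤ 2 * t * Real.sin (θ / 2) := by
      refine le_of_sq_le_sq ((h t ht.le t ht.le).trans (le_of_eq ?_)) (by positivity)
      linear_combination 2 * t ^ 2 * one_sub_cos_eq θ
    have h2 := dist_triangle4 (d t) (c t) (c' t) (d' t)
    have h3 := hK t ht.le
    have h4 := hK' t ht.le
    rw [dist_comm] at h4
    rw [div_le_iff₀ (by positivity)]
    have : (Real.sin (θ / 2) + (K + K') / 2 / t) * (2 * t) =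
        2 * t * Real.sin (θ / 2) + (K + K') := by field_simp
    linarith
  have hlim' : Tendsto (fun t : ℝ => Real.sin (θ / 2) + (K + K') / 2 / t) atTop
      (𝓝 (Real.sin (θ / 2) + 0)) :=
    tendsto_const_nhds.add (tendsto_const_nhds.div_atTop tendsto_id)
  have hle := le_of_tendsto_of_tendsto hlim hlim' bound
  rw [add_zero] at hle
  by_contra hc
  push Not at hc
  refine absurd hle (not_le.2 (Real.sin_lt_sin_of_lt_of_le_pi_div_two ?_ ?_ ?_)) <;> linarith

/-- `c₁` and `c₂` are joined by a Tits curve of length at most `π` of rays from one point. -/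
def Joined (c₁ c₂ : Ray X) : Prop :=
  ∃ f : ℝ → Ray X, (∀ t, 0 ≤ t → f 0 t = c₁ t) ∧ (∀ t, 0 ≤ t → f Real.pi t = c₂ t) ∧
    ∀ u ∈ Icc 0 Real.pi, ∀ v ∈ Icc 0 Real.pi, u ≤ v → AngLE (f u) (f v) (v - u)

theorem mk_eq_of_eq {c c' : Ray X} (h : ∀ t, 0 ≤ t → c t = c' t) :
    (Quotient.mk (raySetoid X) c : Boundary X) = Quotient.mk (raySetoid X) c' :=
  Quotient.sound ⟨0, fun t ht => by rw [h t ht, dist_self]⟩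

/-- The sums over subdivisions telescope. Continuity compares points on both sides of a parameter,
hence both orders in `hh`. -/
theorem titsDist_le_of_lipschitz {L : ℝ} (hL : 0 ≤ L) (h : ℝ → Boundary X)
    (hh : ∀ u v, 0 ≤ u → u ≤ v → v ≤ L →
      titsAngle (h u) (h v) ≤ v - u ∧ titsAngle (h v) (h u) ≤ v - u) :
    titsDist (h 0) (h L) ≤ ENNReal.ofReal L := by
  set τ : unitInterval → Boundary X := fun x => h (L * x) with hτ
  have hmem : ∀ x : unitInterval, 0 ≤ L * (x : ℝ) ∧ L * (x : ℝ) ≤ L := fun x =>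
    ⟨mul_nonneg hL x.2.1, mul_le_of_le_one_right hL x.2.2⟩
  have hdist : ∀ x y : unitInterval, titsAngle (τ x) (τ y) ≤ L * |(x : ℝ) - y| := by
    intro x y
    rcases le_total (x : ℝ) y with hxy | hxy
    · have := (hh _ _ (hmem x).1 (mul_le_mul_of_nonneg_left hxy hL) (hmem y).2).1
      rw [abs_sub_comm, abs_of_nonneg (sub_nonneg.2 hxy)]
      linarith
    · have := (hh _ _ (hmem y).1 (mul_le_mul_of_nonneg_left hxy hL) (hmem x).2).2
      rw [abs_of_nonneg (sub_nonneg.2 hxy)]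
      linarith
  have hcont : TitsContinuous τ := by
    intro s
    refine squeeze_zero (fun t => titsAngle_nonneg _ _) (fun t => hdist s t) ?_
    have : Continuous fun t : unitInterval => L * |(s : ℝ) - t| := by fun_prop
    simpa using this.tendsto s
  have hlen : titsLength τ ≤ ENNReal.ofReal L := by
    refine iSup_le fun n => iSup_le fun u => iSup_le fun hu => ?_
    have hstep : ∀ i, titsAngle (τ (u i)) (τ (u (i + 1))) ≤
        L * (u (i + 1) : ℝ) - L * (u i : ℝ) := by
      intro i
      have hi : (u i : ℝ) ≤ u (i + 1) := hu (Nat.le_succ i)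
      refine (hdist _ _).trans (le_of_eq ?_)
      rw [abs_sub_comm, abs_of_nonneg (sub_nonneg.2 hi), mul_sub]
    rw [← ENNReal.ofReal_sum_of_nonneg fun i _ => titsAngle_nonneg _ _]
    refine ENNReal.ofReal_le_ofReal ((Finset.sum_le_sum fun i _ => hstep i).trans ?_)
    rw [Finset.sum_range_sub fun i => L * (u i : ℝ)]
    linarith [(hmem (u n)).2, (hmem (u 0)).1]
  refine le_trans (iInf_le_of_le τ (iInf_le_of_le hcont (iInf_le_of_le ?_ (iInf_le _ ?_)))) hlen
  · simp [hτ]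
  · simp [hτ]

theorem titsDist_le_two_pi {c₁ c₂ c₃ : Ray X} (h₁ : Joined c₁ c₂) (h₂ : Joined c₂ c₃) :
    titsDist (Quotient.mk (raySetoid X) c₁ : Boundary X) (Quotient.mk (raySetoid X) c₃) ≤
      ENNReal.ofReal (2 * Real.pi) := by
  obtain ⟨f, f0, f1, hf⟩ := h₁
  obtain ⟨g, g0, g1, hg⟩ := h₂
  have hπ := Real.pi_pos
  set h : ℝ → Ray X := fun u => if u ≤ Real.pi then f u else g (u - Real.pi) with hh
  -- Across the junction, angles add by `AngLE.trans`, which needs a total of at most `π`; larger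
  -- parameter gaps are covered at the end by `titsAngle_le_pi`.
  have key : ∀ u v, 0 ≤ u → u ≤ v → v ≤ 2 * Real.pi → v - u ≤ Real.pi →
      AngLE (h u) (h v) (v - u) := by
    intro u v hu huv hv huvπ
    by_cases hu' : u ≤ Real.pi
    · by_cases hv' : v ≤ Real.pi
      · simp only [hh, if_pos hu', if_pos hv']
        exact hf u ⟨hu, hu'⟩ v ⟨hu.trans huv, hv'⟩ huv
      · simp only [hh, if_pos hu', if_neg hv']
        push Not at hv'
        have a1 := hf u ⟨hu, hu'⟩ Real.pi ⟨hπ.le, le_rfl⟩ hu'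
        have a2 := hg 0 ⟨le_rfl, hπ.le⟩ (v - Real.pi) ⟨by linarith, by linarith⟩ (by linarith)
        have a3 := (a1.congr (d₂ := g 0) (fun _ _ => rfl)
          fun t ht => (f1 t ht).trans (g0 t ht).symm).trans a2 (by linarith) (by linarith)
          (by linarith)
        convert a3 using 1
        ring
    · have hv' : ¬ v ≤ Real.pi := fun hc => hu' (huv.trans hc)
      simp only [hh, if_neg hu', if_neg hv']
      push Not at hu' hv'
      have := hg (u - Real.pi) ⟨by linarith, by linarith⟩ (v - Real.pi)
        ⟨by linarith, by linarith⟩ (by linarith)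
      convert this using 1
      ring
  have main := titsDist_le_of_lipschitz (L := 2 * Real.pi) (by positivity)
    (fun u => (Quotient.mk (raySetoid X) (h u) : Boundary X)) ?_
  · have e0 : (Quotient.mk (raySetoid X) (h 0) : Boundary X) = Quotient.mk (raySetoid X) c₁ :=
      mk_eq_of_eq fun t ht => by simp only [hh, if_pos hπ.le]; exact f0 t ht
    have e1 : (Quotient.mk (raySetoid X) (h (2 * Real.pi)) : Boundary X) =
        Quotient.mk (raySetoid X) c₃ :=
      mk_eq_of_eq fun t ht => by
        simp only [hh, if_neg (show ¬ 2 * Real.pi ≤ Real.pi by linarith)]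
        rw [show 2 * Real.pi - Real.pi = Real.pi by ring]
        exact g1 t ht
    rw [e0, e1] at main
    exact main
  · intro u v hu huv hv
    rcases le_total (v - u) Real.pi with hle | hle
    · have := key u v hu huv hv hle
      exact ⟨titsAngle_le this (by linarith) hle, titsAngle_le this.symm (by linarith) hle⟩
    · exact ⟨(titsAngle_le_pi _ _).trans hle, (titsAngle_le_pi _ _).trans hle⟩

end CatZero

/-! ### The angle under which a segment is seen, and escaping segments. -/

namespace CatZero

/-- The cosine of the angle opposite to the side `c` of a triangle with sides `a`, `b`, `c`. -/
noncomputable def cosRule (a b c : ℝ) : ℝ := (a ^ 2 + b ^ 2 - c ^ 2) / (2 * a * b)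

theorem cosRule_mem {a b c : ℝ} (ha : 0 < a) (hb : 0 < b) (h₁ : a ≤ b + c) (h₂ : b ≤ a + c)
    (h₃ : c ≤ a + b) : -1 ≤ cosRule a b c ∧ cosRule a b c ≤ 1 := by
  have hc : 0 ≤ c := by linarith [h₁, h₂]
  rw [cosRule, le_div_iff₀ (by positivity), div_le_iff₀ (by positivity)]
  constructor <;> nlinarith

/-- The two cosines have nonnegative sum, because `|b - c| ≤ l`. -/
theorem arccos_add_arccos_le_pi {l b c : ℝ} (hl : 0 < l) (hb : 0 < b) (hc : 0 < c)
    (h₂ : b ≤ l + c) (h₃ : c ≤ l + b) :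
    Real.arccos (cosRule l b c) + Real.arccos (cosRule l c b) ≤ Real.pi := by
  have : -cosRule l c b ≤ cosRule l b c := by
    have e : cosRule l b c + cosRule l c b = (b + c) * (l ^ 2 - (b - c) ^ 2) / (2 * l * b * c) := by
      rw [cosRule, cosRule]; field_simp; ring
    have : 0 ≤ l ^ 2 - (b - c) ^ 2 := by nlinarith
    have : 0 ≤ cosRule l b c + cosRule l c b := by rw [e]; positivity
    linarith
  have := Real.arccos_le_arccos this
  rw [Real.arccos_neg] at this
  linarith

/-- The law of cosines with the third angle written as `π` minus the other two. The altitude on `l`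
splits that side (`e1`) and is computed from either end (`e5`). -/
theorem sq_eq_cos_arccos_add {l b c : ℝ} (hl : 0 < l) (hb : 0 < b) (hc : 0 < c)
    (h₁ : l ≤ b + c) (h₂ : b ≤ l + c) (h₃ : c ≤ l + b) :
    l ^ 2 = b ^ 2 + c ^ 2 +
      2 * b * c * Real.cos (Real.arccos (cosRule l b c) + Real.arccos (cosRule l c b)) := by
  obtain ⟨m1, m2⟩ := cosRule_mem hl hb h₁ h₂ h₃
  obtain ⟨m3, m4⟩ := cosRule_mem (c := b) hl hc (by linarith) (by linarith) (by linarith)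
  set A := Real.arccos (cosRule l b c)
  set B := Real.arccos (cosRule l c b)
  have cA : Real.cos A = cosRule l b c := Real.cos_arccos m1 m2
  have cB : Real.cos B = cosRule l c b := Real.cos_arccos m3 m4
  have kA : b * Real.cos A = (l ^ 2 + b ^ 2 - c ^ 2) / (2 * l) := by
    rw [cA, cosRule]; field_simp
  have kB : c * Real.cos B = (l ^ 2 + c ^ 2 - b ^ 2) / (2 * l) := by
    rw [cB, cosRule]; field_simp
  have e1 : l = b * Real.cos A + c * Real.cos B := by rw [kA, kB]; field_simp; ring
  have e2 : b ^ 2 - c ^ 2 = (b * Real.cos A - c * Real.cos B) * l := by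
    rw [kA, kB]; field_simp; ring
  have sA : 0 ≤ Real.sin A :=
    Real.sin_nonneg_of_nonneg_of_le_pi (Real.arccos_nonneg _) (Real.arccos_le_pi _)
  have sB : 0 ≤ Real.sin B :=
    Real.sin_nonneg_of_nonneg_of_le_pi (Real.arccos_nonneg _) (Real.arccos_le_pi _)
  have pA := Real.sin_sq_add_cos_sq A
  have pB := Real.sin_sq_add_cos_sq B
  have e3 : (b * Real.sin A) ^ 2 = (c * Real.sin B) ^ 2 := by
    have e4 : b ^ 2 - c ^ 2 =
        (b * Real.cos A - c * Real.cos B) * (b * Real.cos A + c * Real.cos B) := by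
      rw [← e1]; exact e2
    linear_combination b ^ 2 * pA - c ^ 2 * pB + e4
  have e5 : b * Real.sin A = c * Real.sin B :=
    (pow_left_inj₀ (mul_nonneg hb.le sA) (mul_nonneg hc.le sB) two_ne_zero).1 e3
  have e6 : l ^ 2 = (b * Real.cos A + c * Real.cos B) ^ 2 := by rw [← e1]
  rw [Real.cos_add]
  linear_combination e6 + b ^ 2 * pA + c ^ 2 * pB - (b * Real.sin A - c * Real.sin B) * e5

/-- A segment, given by its distance function `d` to a point, can be reparametrized in such a way
that the comparison angle at the point of any two points of the segment is at most the difference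
of the parameters. -/
theorem exists_angular_reparametrization {L : ℝ} (hL : 0 ≤ L) {d : ℝ → ℝ}
    (pos : ∀ s ∈ Icc 0 L, 0 < d s)
    (lip : ∀ s ∈ Icc 0 L, ∀ t ∈ Icc 0 L, |d s - d t| ≤ |s - t|)
    (tri : ∀ s ∈ Icc 0 L, ∀ t ∈ Icc 0 L, |s - t| ≤ d s + d t)
    (cn : ∀ s ∈ Icc 0 L, ∀ t ∈ Icc 0 L, ∀ r ∈ Icc 0 L, s < r → r < t →
      (t - s) * d r ^ 2 ≤ (t - r) * d s ^ 2 + (r - s) * d t ^ 2 - (t - r) * (r - s) * (t - s)) :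
    ∃ σ : ℝ → ℝ, σ 0 = 0 ∧ σ Real.pi = L ∧ (∀ u ∈ Icc 0 Real.pi, σ u ∈ Icc 0 L) ∧
      ∀ u ∈ Icc 0 Real.pi, ∀ v ∈ Icc 0 Real.pi, u ≤ v →
        (σ u - σ v) ^ 2 ≤
          d (σ u) ^ 2 + d (σ v) ^ 2 - 2 * d (σ u) * d (σ v) * Real.cos (v - u) := by
  have hπ := Real.pi_pos
  have tris : ∀ s ∈ Icc 0 L, ∀ t ∈ Icc 0 L, s < t →
      t - s ≤ d s + d t ∧ d s ≤ (t - s) + d t ∧ d t ≤ (t - s) + d s := by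
    intro s hs t ht hst
    have h1 := tri s hs t ht
    have h2 := abs_le.1 (lip s hs t ht)
    rw [abs_sub_comm, abs_of_pos (sub_pos.2 hst)] at h1 h2
    exact ⟨h1, by linarith [h2.2], by linarith [h2.1]⟩
  -- `ang s t` is the comparison angle at the point `s` between the point `t` and the observer, and
  -- `a s` is the infimum of these over `t > s`. Inserting `π` keeps the set nonempty and makes `a L
  -- = π`.
  set ang : ℝ → ℝ → ℝ := fun s t => Real.arccos (cosRule |t - s| (d s) (d t)) with hang
  set S : ℝ → Set ℝ := fun s => insert Real.pi (ang s '' Ioc s L) with hS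
  set a : ℝ → ℝ := fun s => sInf (S s) with ha
  have S_nonneg : ∀ s, ∀ x ∈ S s, 0 ≤ x := by
    rintro s x (rfl | ⟨t, -, rfl⟩)
    · exact hπ.le
    · exact Real.arccos_nonneg _
  have S_bdd : ∀ s, BddBelow (S s) := fun s => ⟨0, S_nonneg s⟩
  have a_le_pi : ∀ s, a s ≤ Real.pi := fun s => csInf_le (S_bdd s) (mem_insert _ _)
  have a_nonneg : ∀ s, 0 ≤ a s := fun s => le_csInf ⟨_, mem_insert _ _⟩ (S_nonneg s)
  have a_L : a L = Real.pi := by simp [ha, hS]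
  -- The left side is the comparison angle at the observer. The bound on `a t` holds because
  -- backward and forward comparison angles at `t` add up to at least `π`, by `cn`.
  have key : ∀ s ∈ Icc 0 L, ∀ t ∈ Icc 0 L, s < t →
      Real.pi - ang s t - ang t s ≤ a t - a s := by
    intro s hs t ht hst
    have h1 : a s ≤ ang s t := csInf_le (S_bdd s) (mem_insert_of_mem _ ⟨t, ⟨hst, ht.2⟩, rfl⟩)
    have h2 : Real.pi - ang t s ≤ a t := by
      refine le_csInf ⟨_, mem_insert _ _⟩ ?_
      rintro x (rfl | ⟨t', ht', rfl⟩)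
      · linarith [Real.arccos_nonneg (cosRule |s - t| (d t) (d s))]
      · have hmem : t' ∈ Icc 0 L := ⟨ht.1.trans ht'.1.le, ht'.2⟩
        have e := cn s hs t' hmem t ht hst ht'.1
        have ht0 := pos t ht
        have hle : cosRule |t' - t| (d t) (d t') ≤ -cosRule |s - t| (d t) (d s) := by
          rw [abs_of_pos (sub_pos.2 ht'.1), abs_sub_comm, abs_of_pos (sub_pos.2 hst)]
          set m := t - s with hm
          set n := t' - t with hn
          have hm0 : 0 < m := sub_pos.2 hst
          have hn0 : 0 < n := sub_pos.2 ht'.1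
          rw [show t' - s = m + n by ring] at e
          have : cosRule n (d t) (d t') + cosRule m (d t) (d s) =
              -(n * d s ^ 2 + m * d t' ^ 2 - n * m * (m + n) - (m + n) * d t ^ 2) /
                (2 * m * n * d t) := by
            rw [cosRule, cosRule]; field_simp; ring
          have h0 : cosRule n (d t) (d t') + cosRule m (d t) (d s) ≤ 0 := by
            rw [this]
            exact div_nonpos_of_nonpos_of_nonneg (by linarith) (by positivity)
          linarith
        have := Real.arccos_le_arccos hle
        rw [Real.arccos_neg] at this
        exact this
    linarith
  have sum_le : ∀ s ∈ Icc 0 L, ∀ t ∈ Icc 0 L, s < t → ang s t + ang t s ≤ Real.pi := by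
    intro s hs t ht hst
    obtain ⟨-, h2, h3⟩ := tris s hs t ht hst
    simp only [hang]
    rw [abs_of_pos (sub_pos.2 hst), abs_sub_comm, abs_of_pos (sub_pos.2 hst)]
    exact arccos_add_arccos_le_pi (sub_pos.2 hst) (pos s hs) (pos t ht) h2 h3
  have mono : ∀ s ∈ Icc 0 L, ∀ t ∈ Icc 0 L, s < t → a s ≤ a t := fun s hs t ht hst => by
    linarith [key s hs t ht hst, sum_le s hs t ht hst]
  have cosb : ∀ s ∈ Icc 0 L, ∀ t ∈ Icc 0 L, s < t → ∀ θ, a t - a s ≤ θ → θ ≤ Real.pi →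
      (s - t) ^ 2 ≤ d s ^ 2 + d t ^ 2 - 2 * d s * d t * Real.cos θ := by
    intro s hs t ht hst θ hθ hθπ
    obtain ⟨h1, h2, h3⟩ := tris s hs t ht hst
    have e := sq_eq_cos_arccos_add (sub_pos.2 hst) (pos s hs) (pos t ht) h1 h2 h3
    have k := key s hs t ht hst
    have k' := sum_le s hs t ht hst
    simp only [hang] at k k'
    rw [abs_of_pos (sub_pos.2 hst), abs_sub_comm s t, abs_of_pos (sub_pos.2 hst)] at k k'
    set A := Real.arccos (cosRule (t - s) (d s) (d t))
    set B := Real.arccos (cosRule (t - s) (d t) (d s))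
    have hc : Real.cos θ ≤ -Real.cos (A + B) := by
      rw [← Real.cos_pi_sub]
      exact Real.cos_le_cos_of_nonneg_of_le_pi (by linarith) hθπ (by linarith)
    have := mul_le_mul_of_nonneg_left hc (mul_pos (pos s hs) (pos t ht)).le
    nlinarith
  set T : ℝ → Set ℝ := fun u => {s ∈ Icc 0 L | u ≤ a s} with hT
  have L_mem : ∀ u, u ≤ Real.pi → L ∈ T u := fun u hu => ⟨⟨hL, le_rfl⟩, hu.trans a_L.ge⟩
  have T_bdd : ∀ u, BddBelow (T u) := fun u => ⟨0, fun s hs => hs.1.1⟩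
  -- A generalized inverse of the monotone function `a`. At `π` the value `L` is prescribed, since
  -- `a` may reach `π` earlier.
  set σ : ℝ → ℝ := fun u => if u < Real.pi then sInf (T u) else L with hσ
  have σ_mem : ∀ u ∈ Icc 0 Real.pi, σ u ∈ Icc 0 L := by
    intro u hu
    simp only [hσ]
    split_ifs with h
    · exact ⟨le_csInf ⟨L, L_mem u hu.2⟩ fun s hs => hs.1.1, csInf_le (T_bdd u) (L_mem u hu.2)⟩
    · exact ⟨hL, le_rfl⟩
  have σ_mono : ∀ u ∈ Icc 0 Real.pi, ∀ v ∈ Icc 0 Real.pi, u ≤ v → σ u ≤ σ v := by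
    intro u hu v hv huv
    by_cases hv' : v < Real.pi
    · simp only [hσ, if_pos hv', if_pos (huv.trans_lt hv')]
      exact csInf_le_csInf (T_bdd u) ⟨L, L_mem v hv.2⟩ fun s hs => ⟨hs.1, huv.trans hs.2⟩
    · exact (σ_mem u hu).2.trans (by simp only [hσ, if_neg hv']; rfl)
  have below : ∀ v ∈ Icc 0 Real.pi, ∀ t ∈ Icc 0 L, t < σ v → a t ≤ v := by
    intro v hv t ht htv
    by_cases hv' : v < Real.pi
    · simp only [hσ, if_pos hv'] at htv
      by_contra hc
      push Not at hc
      exact absurd (csInf_le (T_bdd v) ⟨ht, hc.le⟩) (not_le.2 htv)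
    · exact (a_le_pi t).trans (not_lt.1 hv')
  have above : ∀ u ∈ Icc 0 Real.pi, u < Real.pi → ∀ s ∈ Icc 0 L, σ u < s → u ≤ a s := by
    intro u hu hu' s hs hus
    simp only [hσ, if_pos hu'] at hus
    obtain ⟨s', hs', hlt⟩ := exists_lt_of_csInf_lt ⟨L, L_mem u hu.2⟩ hus
    exact hs'.2.trans (mono s' hs'.1 s hs hlt)
  have cont : ContinuousOn d (Icc 0 L) := by
    refine LipschitzOnWith.continuousOn (K := 1) (LipschitzOnWith.of_dist_le_mul ?_)
    intro s hs t ht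
    simpa [Real.dist_eq] using lip s hs t ht
  refine ⟨σ, ?_, by simp [hσ], σ_mem, fun u hu v hv huv => ?_⟩
  · have h0 : (0 : ℝ) ∈ T 0 := ⟨⟨le_rfl, hL⟩, a_nonneg 0⟩
    simp only [hσ, if_pos hπ]
    exact le_antisymm (csInf_le (T_bdd 0) h0) (le_csInf ⟨0, h0⟩ fun s hs => hs.1.1)
  rcases (σ_mono u hu v hv huv).eq_or_lt with h | h
  · rw [h]
    nlinarith [Real.cos_le_one (v - u), sq_nonneg (d (σ v))]
  have hu' : u < Real.pi := by
    rcases hu.2.lt_or_eq with h' | h'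
    · exact h'
    · have : u = v := le_antisymm huv (by rw [h']; exact hv.2)
      rw [this] at h
      exact absurd h (lt_irrefl _)
  have mu := σ_mem u hu
  have mv := σ_mem v hv
  -- As `a` may jump at `σ u` and `σ v`, the estimate is made at `σ u + ε` and `σ v - ε`, and then
  -- `ε → 0`.
  have ev : ∀ᶠ ε in 𝓝[>] (0 : ℝ), 0 < ε ∧ ε < (σ v - σ u) / 2 :=
    Ioo_mem_nhdsGT (by linarith)
  have memu : ∀ᶠ ε in 𝓝[>] (0 : ℝ), σ u + ε ∈ Icc 0 L := by
    filter_upwards [ev] with ε hε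
    exact ⟨by linarith [mu.1], by linarith [mv.2]⟩
  have memv : ∀ᶠ ε in 𝓝[>] (0 : ℝ), σ v - ε ∈ Icc 0 L := by
    filter_upwards [ev] with ε hε
    exact ⟨by linarith [mu.1], by linarith [mv.2]⟩
  have tu : Tendsto (fun ε => σ u + ε) (𝓝[>] (0 : ℝ)) (𝓝 (σ u)) := by
    have : Continuous fun ε => σ u + ε := by fun_prop
    simpa using (this.tendsto 0).mono_left nhdsWithin_le_nhds
  have tv : Tendsto (fun ε => σ v - ε) (𝓝[>] (0 : ℝ)) (𝓝 (σ v)) := by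
    have : Continuous fun ε => σ v - ε := by fun_prop
    simpa using (this.tendsto 0).mono_left nhdsWithin_le_nhds
  have du : Tendsto (fun ε => d (σ u + ε)) (𝓝[>] (0 : ℝ)) (𝓝 (d (σ u))) :=
    (cont _ mu).tendsto.comp (tendsto_nhdsWithin_iff.2 ⟨tu, memu⟩)
  have dv : Tendsto (fun ε => d (σ v - ε)) (𝓝[>] (0 : ℝ)) (𝓝 (d (σ v))) :=
    (cont _ mv).tendsto.comp (tendsto_nhdsWithin_iff.2 ⟨tv, memv⟩)
  refine le_of_tendsto_of_tendsto ((tu.sub tv).pow 2)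
    (((du.pow 2).add (dv.pow 2)).sub (((tendsto_const_nhds.mul du).mul dv).mul_const _)) ?_
  filter_upwards [ev, memu, memv] with ε hε hεu hεv
  refine cosb _ hεu _ hεv (by linarith) _ ?_ (by linarith [hv.2, hu.1])
  have h1 := below v hv _ hεv (by linarith [hε.1])
  have h2 := above u hu hu' _ hεu (by linarith [hε.1])
  linarith

variable {X : Type*} [MetricSpace X]

namespace IsHadamardSpace

variable {hX : IsHadamardSpace X}

theorem exists_segment_reparametrization (hX : IsHadamardSpace X) (p x y : X)
    (h : ∀ l ∈ Icc (0 : ℝ) 1, 0 < dist p (hX.pt x y l)) :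
    ∃ w : ℝ → ℝ, w 0 = 0 ∧ w Real.pi = 1 ∧ (∀ u ∈ Icc 0 Real.pi, w u ∈ Icc (0 : ℝ) 1) ∧
      ∀ u ∈ Icc 0 Real.pi, ∀ v ∈ Icc 0 Real.pi, u ≤ v →
        dist (hX.pt x y (w u)) (hX.pt x y (w v)) ^ 2 ≤
          dist p (hX.pt x y (w u)) ^ 2 + dist p (hX.pt x y (w v)) ^ 2 -
          2 * dist p (hX.pt x y (w u)) * dist p (hX.pt x y (w v)) * Real.cos (v - u) := by
  rcases eq_or_ne x y with rfl | hxy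
  · have hpt : ∀ l ∈ Icc (0 : ℝ) 1, hX.pt x x l = x := fun l hl => by
      have := hX.dist_left_pt x x hl
      rw [dist_self, mul_zero] at this
      exact (dist_eq_zero.1 this).symm
    have hπ := Real.pi_pos
    have hw : ∀ u ∈ Icc 0 Real.pi, u / Real.pi ∈ Icc (0 : ℝ) 1 := fun u hu =>
      div_mem hu.1 hu.2
    refine ⟨fun u => u / Real.pi, by simp, div_self hπ.ne', hw, fun u hu v hv _ => ?_⟩
    rw [hpt _ (hw u hu), hpt _ (hw v hv), dist_self]
    nlinarith [Real.cos_le_one (v - u), sq_nonneg (dist p x)]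
  have hL : 0 < dist x y := dist_pos.2 hxy
  have hd : ∀ s ∈ Icc 0 (dist x y), ∀ t ∈ Icc 0 (dist x y),
      dist (hX.geo x y s) (hX.geo x y t) = |s - t| := fun s hs t ht =>
    hX.dist_geo_geo x y hs.1 hs.2 ht.1 ht.2
  obtain ⟨σ, σ0, σ1, hσ, H⟩ := exists_angular_reparametrization hL.le
    (d := fun s => dist p (hX.geo x y s)) (fun s hs => h _ (div_mem hs.1 hs.2))
    (fun s hs t ht => by
      rw [← hd s hs t ht, dist_comm p, dist_comm p]; exact abs_dist_sub_le _ _ _)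
    (fun s hs t ht => by rw [← hd s hs t ht]; exact dist_triangle_left _ _ _)
    (fun s hs t ht r hr hsr hrt => by
      have hts : 0 < t - s := by linarith
      have hl : (r - s) / (t - s) ∈ Icc (0 : ℝ) 1 := div_mem (by linarith) (by linarith)
      have e : hX.geo x y r = hX.pt (hX.geo x y s) (hX.geo x y t) ((r - s) / (t - s)) := by
        refine hX.eq_pt hl ?_ ?_
        · rw [hd s hs r hr, hd s hs t ht, abs_sub_comm, abs_of_pos (sub_pos.2 hsr),
            abs_sub_comm, abs_of_pos hts, div_mul_cancel₀ _ hts.ne']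
        · rw [hd r hr t ht, hd s hs t ht, abs_sub_comm, abs_of_pos (sub_pos.2 hrt),
            abs_sub_comm, abs_of_pos hts, sub_mul, div_mul_cancel₀ _ hts.ne']
          linarith
      have k := hX.dist_pt_sq_le p (hX.geo x y s) (hX.geo x y t) hl
      rw [← e, hd s hs t ht, abs_sub_comm, abs_of_pos hts] at k
      have k2 := mul_le_mul_of_nonneg_left k hts.le
      refine k2.trans (le_of_eq ?_)
      field_simp
      ring)
  refine ⟨fun u => σ u / dist x y, by simp [σ0], by simp [σ1, hL.ne'],
    fun u hu => div_mem (hσ u hu).1 (hσ u hu).2, fun u hu v hv huv => ?_⟩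
  have := H u hu v hv huv
  rw [← sq_abs, ← hd _ (hσ u hu) _ (hσ v hv)] at this
  exact this

/-- If the segments between two sequences converging to ideal points leave every bounded set,
then the ideal points have Tits distance at most `π`. -/
theorem Conv.joined [ProperSpace X] {ω : Ultrafilter ℕ} {p : X} {x y : ℕ → X} {c₁ c₂ : Ray X}
    (h₁ : hX.Conv ω p x c₁) (h₂ : hX.Conv ω p y c₂)
    (h : ∀ R : ℝ, ∀ᶠ i in (ω : Filter ℕ), ∀ l ∈ Icc (0 : ℝ) 1,
      R < dist p (hX.pt (x i) (y i) l)) : Joined c₁ c₂ := by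
  have hπ := Real.pi_pos
  have hw : ∀ i, ∃ w : ℝ → ℝ, (∀ l ∈ Icc (0 : ℝ) 1, 0 < dist p (hX.pt (x i) (y i) l)) →
      w 0 = 0 ∧ w Real.pi = 1 ∧ (∀ u ∈ Icc 0 Real.pi, w u ∈ Icc (0 : ℝ) 1) ∧
      ∀ u ∈ Icc 0 Real.pi, ∀ v ∈ Icc 0 Real.pi, u ≤ v →
        dist (hX.pt (x i) (y i) (w u)) (hX.pt (x i) (y i) (w v)) ^ 2 ≤
          dist p (hX.pt (x i) (y i) (w u)) ^ 2 + dist p (hX.pt (x i) (y i) (w v)) ^ 2 -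
          2 * dist p (hX.pt (x i) (y i) (w u)) * dist p (hX.pt (x i) (y i) (w v)) *
            Real.cos (v - u) := by
    intro i
    by_cases hi : ∀ l ∈ Icc (0 : ℝ) 1, 0 < dist p (hX.pt (x i) (y i) l)
    · obtain ⟨w, hw⟩ := hX.exists_segment_reparametrization p (x i) (y i) hi
      exact ⟨w, fun _ => hw⟩
    · exact ⟨id, fun h' => absurd h' hi⟩
  choose w hw using hw
  have hw' : ∀ᶠ i in (ω : Filter ℕ), _ := (h 0).mono fun i hi => hw i hi
  have tend : ∀ u ∈ Icc 0 Real.pi,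
      Tendsto (fun i => dist p (hX.pt (x i) (y i) (w i u))) ω atTop := by
    intro u hu
    refine tendsto_atTop.2 fun R => ?_
    filter_upwards [h R, hw'] with i hi hi'
    exact (hi _ (hi'.2.2.1 u hu)).le
  -- The ultrafilter provides limits for all `u` at once, where a subsequence would depend on `u`.
  have hf : ∀ u, ∃ c : Ray X, u ∈ Icc 0 Real.pi →
      hX.Conv ω p (fun i => hX.pt (x i) (y i) (w i u)) c := by
    intro u
    by_cases hu : u ∈ Icc 0 Real.pi
    · obtain ⟨c, hc⟩ := hX.exists_conv ω p _ (tend u hu)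
      exact ⟨c, fun _ => hc⟩
    · exact ⟨c₁, fun h' => absurd h' hu⟩
  choose f hf using hf
  have m0 : (0 : ℝ) ∈ Icc 0 Real.pi := ⟨le_rfl, hπ.le⟩
  have m1 : Real.pi ∈ Icc 0 Real.pi := ⟨hπ.le, le_rfl⟩
  refine ⟨f, fun t ht => ?_, fun t ht => ?_, fun u hu v hv huv s hs t ht => ?_⟩
  · refine tendsto_nhds_unique ((hf 0 m0).geo_tendsto t ht)
      ((h₁.geo_tendsto t ht).congr' ?_)
    filter_upwards [hw'] with i hi
    rw [hi.1, pt_zero]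
  · refine tendsto_nhds_unique ((hf _ m1).geo_tendsto t ht)
      ((h₂.geo_tendsto t ht).congr' ?_)
    filter_upwards [hw'] with i hi
    rw [hi.2.1, pt_one]
  · refine le_of_tendsto
      ((((hf u hu).geo_tendsto s hs).dist ((hf v hv).geo_tendsto t ht)).pow 2) ?_
    filter_upwards [hw', (hf u hu).dist_tendsto.eventually_ge_atTop s,
      (hf v hv).dist_tendsto.eventually_ge_atTop t] with i hi hs' ht'
    exact hX.angle_mono_geo p _ _ hs hs' ht ht' (hi.2.2.2 u hu v hv huv)

end IsHadamardSpace

end CatZero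

/-! ### Tight pairs, ping-pong and rank one isometries. -/

namespace CatZero

variable {X : Type*} [MetricSpace X]

namespace IsHadamardSpace

variable (hX : IsHadamardSpace X)

/-- The basic neighbourhoods of the endpoint of the ray `c` from `p` in the cone topology. -/
def Near (p : X) (N : ℝ) (c : Ray X) (x : X) : Prop :=
  N ≤ dist p x ∧ dist (hX.geo p x N) (c N) ≤ 1

/-- Segments between neighbourhoods of the endpoints of `c₁` and `c₂` pass near `p`. -/
def Tight (p : X) (N : ℝ) (c₁ c₂ : Ray X) : Prop :=
  ∀ x y, hX.Near p N c₁ x → hX.Near p N c₂ y → ∃ l ∈ Icc (0 : ℝ) 1, dist p (hX.pt x y l) ≤ N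

variable {hX}

theorem Tight.symm {p : X} {N : ℝ} {c₁ c₂ : Ray X} (h : hX.Tight p N c₁ c₂) :
    hX.Tight p N c₂ c₁ := by
  intro x y hx hy
  obtain ⟨l, hl, hd⟩ := h y x hy hx
  rw [hX.pt_symm y x hl] at hd
  exact ⟨1 - l, ⟨sub_nonneg.2 hl.2, by linarith [hl.1]⟩, hd⟩

theorem Near.dist_geo_le {p : X} {N : ℝ} {c : Ray X} {x : X} (h : hX.Near p N c x)
    (hc : c 0 = p) {t : ℝ} (ht : 0 ≤ t) (htN : t ≤ N) :
    dist (hX.geo p x t) (c t) ≤ 2 * t / N := by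
  have hN : 0 ≤ N := ht.trans htN
  have hpc : dist p (c N) = N := by
    rw [← hc, c.isometric 0 le_rfl N hN, zero_sub, abs_neg, abs_of_nonneg hN]
  have hseg : IsSegment c p (c N) := by
    refine ⟨hc, by rw [hpc], fun s hs t ht => c.isometric s hs.1 t ht.1⟩
  have hpg := hX.dist_left_geo p x hN h.1
  have e1 : hX.geo p x t = hX.geo p (hX.geo p x N) t := by
    rw [geo.eq_def hX p x N] at hpg ⊢
    rw [hX.geo_pt p x (div_mem hN h.1) ht (by rw [hpg]; exact htN)]
  rw [e1, hX.segment_eq_geo hseg ht (by rw [hpc]; exact htN)]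
  refine (hX.dist_geo_le_div p _ _ ht (by rw [hpg]; exact htN) (by rw [hpc]; exact htN)).trans ?_
  rw [hpg]
  exact div_le_div_of_nonneg_right (mul_le_of_le_one_right (by positivity) h.2) hN

/-- Failure of tightness for every `N = n + 1` yields sequences converging to both endpoints whose
connecting segments escape, so `Conv.joined` applies. -/
theorem exists_tight [ProperSpace X] (hX : IsHadamardSpace X) {p : X} {c₁ c₂ : Ray X}
    (h₁ : c₁ 0 = p) (h₂ : c₂ 0 = p) (hJ : ¬ Joined c₁ c₂) :
    ∃ N : ℝ, 1 ≤ N ∧ hX.Tight p N c₁ c₂ := by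
  by_contra hne
  push Not at hne
  have hex : ∀ n : ℕ, ∃ x y, hX.Near p (n + 1) c₁ x ∧ hX.Near p (n + 1) c₂ y ∧
      ∀ l ∈ Icc (0 : ℝ) 1, (n : ℝ) + 1 < dist p (hX.pt x y l) := by
    intro n
    have := hne (n + 1) (by linarith [n.cast_nonneg (α := ℝ)])
    simp only [Tight] at this
    push Not at this
    exact this
  choose x y hx hy hxy using hex
  set ω : Ultrafilter ℕ := hyperfilter ℕ
  have hω : (ω : Filter ℕ) ≤ atTop := Nat.hyperfilter_le_atTop
  have htop : Tendsto (fun n : ℕ => (n : ℝ) + 1) ω atTop :=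
    (tendsto_atTop_add_const_right _ 1 tendsto_natCast_atTop_atTop).mono_left hω
  have conv : ∀ (z : ℕ → X) (c : Ray X), c 0 = p → (∀ n : ℕ, hX.Near p (n + 1) c (z n)) →
      hX.Conv ω p z c := by
    intro z c hc hz
    refine ⟨tendsto_atTop_mono (fun n => (hz n).1) htop, fun t ht => ?_⟩
    refine tendsto_iff_dist_tendsto_zero.2 (squeeze_zero' (Eventually.of_forall fun _ =>
      dist_nonneg) ?_ ((tendsto_const_nhds (x := 2 * t)).div_atTop htop))
    filter_upwards [htop.eventually_ge_atTop t] with n hn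
    exact (hz n).dist_geo_le hc ht hn
  refine hJ ((conv x c₁ h₁ hx).joined (conv y c₂ h₂ hy) fun R => ?_)
  filter_upwards [htop.eventually_ge_atTop R] with n hn l hl
  exact hn.trans_lt (hxy n l hl)

theorem Conv.eventually_near {ω : Filter ℕ} {p : X} {x : ℕ → X} {c : Ray X}
    (h : hX.Conv ω p x c) {N : ℝ} (hN : 0 ≤ N) : ∀ᶠ i in ω, hX.Near p N c (x i) := by
  have := (tendsto_iff_dist_tendsto_zero.1 (h.geo_tendsto N hN)).eventually_lt_const one_pos
  filter_upwards [this, h.dist_tendsto.eventually_ge_atTop N] with i hi hi'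
  exact ⟨hi', hi.le⟩

/-- The segment from `(g i)⁻¹ p` to `h i p` passes near `p`. Its image under `g i` runs from `p` to
`g i (h i p)` and passes near `g i p`, so both points have the same limit. -/
theorem Conv.mul {ω : Filter ℕ} {p : X} {g h : ℕ → X ≃ᵢ X} {c c' d : Ray X} {N : ℝ}
    (hN : 0 ≤ N) (hg : hX.Conv ω p (fun i => g i p) c)
    (hg' : hX.Conv ω p (fun i => (g i)⁻¹ p) c') (hh : hX.Conv ω p (fun i => h i p) d)
    (ht : hX.Tight p N c' d) : hX.Conv ω p (fun i => (g i * h i) p) c := by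
  have hex : ∀ i, ∃ l : ℝ, hX.Near p N c' ((g i)⁻¹ p) → hX.Near p N d (h i p) →
      l ∈ Icc (0 : ℝ) 1 ∧ dist p (hX.pt ((g i)⁻¹ p) (h i p) l) ≤ N := by
    intro i
    by_cases hi : hX.Near p N c' ((g i)⁻¹ p) ∧ hX.Near p N d (h i p)
    · obtain ⟨l, hl, hd⟩ := ht _ _ hi.1 hi.2
      exact ⟨l, fun _ _ => ⟨hl, hd⟩⟩
    · exact ⟨0, fun h1 h2 => absurd ⟨h1, h2⟩ hi⟩
  choose l hl using hex
  have ev : ∀ᶠ i in ω, l i ∈ Icc (0 : ℝ) 1 ∧ dist p (hX.pt ((g i)⁻¹ p) (h i p) (l i)) ≤ N := by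
    filter_upwards [hg'.eventually_near hN, hh.eventually_near hN] with i h1 h2
    exact hl i h1 h2
  refine hg.of_dist_le (R := N) (ev.mono fun i hi => hi.1) (ev.mono fun i hi => ?_)
  have := hi.2
  rwa [← (g i).dist_eq, hX.map_pt (g i) _ _ hi.1, IsometryEquiv.apply_inv_self,
    ← IsometryEquiv.mul_apply] at this

/-- The ping-pong argument: the positive powers of `k` move `p` towards the endpoint of `c₁`. -/
theorem Tight.pow_near {p : X} {N : ℝ} {c₁ c₂ : Ray X} (ht : hX.Tight p N c₁ c₂) (hN : 1 ≤ N)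
    {k : X ≃ᵢ X} (hk : 6 * N ^ 2 + 2 * N + 1 ≤ dist p (k p))
    (hk₁ : dist (hX.geo p (k p) N) (c₁ N) ≤ 1 / 3) (hk₂ : hX.Near p N c₂ (k⁻¹ p)) (m : ℕ) :
    dist (hX.geo p ((k ^ (m + 1)) p) N) (c₁ N) ≤ 2 / 3 ∧
      m + (6 * N ^ 2 + 2 * N + 1) ≤ dist p ((k ^ (m + 1)) p) := by
  have hN0 : 0 ≤ N := zero_le_one.trans hN
  have hN2 : 0 ≤ N ^ 2 := sq_nonneg N
  induction m with
  | zero => simpa using ⟨by linarith, hk⟩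
  | succ m ih =>
    have hm : (0 : ℝ) ≤ m := m.cast_nonneg
    -- Tightness for `k ^ (m + 1) p` and `k⁻¹ p`, moved by `k`: the segment from `p` to the next
    -- orbit point passes within `N` of `k p`.
    obtain ⟨l, hl, hd⟩ := ht _ _ ⟨by linarith [ih.2], ih.1.trans (by norm_num)⟩ hk₂
    have e : k ((k ^ (m + 1)) p) = (k ^ (m + 1 + 1)) p := by
      rw [pow_succ' k (m + 1), IsometryEquiv.mul_apply]
    have hl' : 1 - l ∈ Icc (0 : ℝ) 1 := ⟨sub_nonneg.2 hl.2, by linarith [hl.1]⟩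
    rw [← k.dist_eq, hX.map_pt k _ _ hl, IsometryEquiv.apply_inv_self, e,
      hX.pt_symm _ _ hl] at hd
    have hq : dist (k p) ((k ^ (m + 1 + 1)) p) = dist p ((k ^ (m + 1)) p) := by
      rw [← e, k.dist_eq]
    set q := (k ^ (m + 1 + 1)) p
    set w := hX.pt p q (1 - l) with hw
    have t1 := dist_triangle p w (k p)
    have t2 := dist_triangle (k p) w q
    have t3 : dist p w + dist w q = dist p q := by
      rw [hw, hX.dist_left_pt p q hl', hX.dist_pt_right p q hl']; ring
    rw [dist_comm w (k p)] at t1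
    have hNw : N ≤ dist p w := by linarith
    constructor
    · have h1 := hX.dist_geo_le_div p (k p) w hN0 (by linarith) hNw
      rw [hX.geo_pt p q hl' hN0 hNw] at h1
      -- The term `6 * N ^ 2` is chosen for this quotient. With the `1 / 3` from `hk₁` the error is
      -- `2 / 3` at every step, leaving `1 / 3` for later perturbations.
      have h2 : 2 * N * dist (k p) w / dist p (k p) ≤ 1 / 3 := by
        rw [div_le_iff₀ (by linarith)]
        nlinarith
      rw [dist_comm] at h1
      linarith [dist_triangle (hX.geo p q N) (hX.geo p (k p) N) (c₁ N)]
    · push_cast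
      linarith [ih.2]

theorem Tight.exists_forall_near {p : X} {N : ℝ} {c₁ c₂ : Ray X} (ht : hX.Tight p N c₁ c₂)
    (hN : 1 ≤ N) {k : X ≃ᵢ X} (hk : 6 * N ^ 2 + 2 * N + 1 ≤ dist p (k p))
    (hk₁ : dist (hX.geo p (k p) N) (c₁ N) ≤ 1 / 3) (hk₂ : hX.Near p N c₂ (k⁻¹ p)) (D : ℝ) :
    ∃ M : ℕ, ∀ m ≥ M, ∀ x, dist x ((k ^ m) p) ≤ D → hX.Near p N c₁ x := by
  -- `6 * N * D` makes the perturbation cost at most `1 / 3`; the extra `D` keeps `x` at distance at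
  -- least `N` from `p`.
  obtain ⟨M, hM⟩ := exists_nat_ge (6 * N * D + D)
  refine ⟨M + 1, fun m hm x hx => ?_⟩
  obtain ⟨j, rfl⟩ : ∃ j, m = j + 1 := ⟨m - 1, by omega⟩
  have hj : (M : ℝ) ≤ j := by exact_mod_cast Nat.le_of_succ_le_succ hm
  obtain ⟨h1, h2⟩ := ht.pow_near hN hk hk₁ hk₂ j
  have hN0 : 0 ≤ N := zero_le_one.trans hN
  have hD : 0 ≤ D := dist_nonneg.trans hx
  have hND : 0 ≤ N * D := mul_nonneg hN0 hD
  have hN2 : 0 ≤ N ^ 2 := sq_nonneg N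
  have t1 := dist_triangle p x ((k ^ (j + 1)) p)
  have hpx : N ≤ dist p x := by nlinarith
  refine ⟨hpx, ?_⟩
  have h3 := hX.dist_geo_le_div p ((k ^ (j + 1)) p) x hN0 (by nlinarith) hpx
  have h4 : 2 * N * dist ((k ^ (j + 1)) p) x / dist p ((k ^ (j + 1)) p) ≤ 1 / 3 := by
    rw [div_le_iff₀ (by nlinarith), dist_comm _ x]
    have := mul_le_mul_of_nonneg_left hx hN0
    nlinarith
  rw [dist_comm] at h3
  linarith [dist_triangle (hX.geo p x N) (hX.geo p ((k ^ (j + 1)) p) N) (c₁ N)]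

/-- `k` maps the midpoint of `q` and `k q` to that of `k q` and `k ^ 2 q`; these are at most half of
`dist q (k ^ 2 q)` apart. -/
theorem two_mul_le_displacement_sq (hX : IsHadamardSpace X) {k : X ≃ᵢ X} {a : ℝ}
    (h : ∀ q, a ≤ dist q (k q)) (q : X) : 2 * a ≤ dist q ((k ^ 2) q) := by
  have half : (1 / 2 : ℝ) ∈ Icc (0 : ℝ) 1 := by norm_num
  have h1 := h (hX.pt q (k q) (1 / 2))
  rw [hX.map_pt k _ _ half, hX.pt_symm q (k q) half, show (1 - 1 / 2 : ℝ) = 1 / 2 by norm_num,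
    ← IsometryEquiv.mul_apply k k, ← pow_two] at h1
  have h2 := hX.dist_pt_same_left (k q) q ((k ^ 2) q) half
  linarith

theorem pow_two_mul_le_displacement (hX : IsHadamardSpace X) {k : X ≃ᵢ X} {a : ℝ}
    (h : ∀ q, a ≤ dist q (k q)) (j : ℕ) (q : X) : 2 ^ j * a ≤ dist q ((k ^ 2 ^ j) q) := by
  induction j generalizing q with
  | zero => simpa using h q
  | succ j ih =>
    have := hX.two_mul_le_displacement_sq ih q
    rw [← pow_mul, ← pow_succ] at this
    rw [pow_succ (2 : ℝ) j]
    linarith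

theorem dist_pow_le (k : X ≃ᵢ X) (x : X) (m : ℕ) : dist x ((k ^ m) x) ≤ m * dist x (k x) := by
  induction m with
  | zero => simp
  | succ m ih =>
    have := dist_triangle x ((k ^ m) x) ((k ^ (m + 1)) x)
    rw [pow_succ k m, IsometryEquiv.mul_apply, (k ^ m).dist_eq] at this
    rw [pow_succ k m, IsometryEquiv.mul_apply]
    push_cast
    linarith

/-- An isometry whose displacement function attains a positive minimum is hyperbolic. -/
theorem isHyperbolic_of_min (hX : IsHadamardSpace X) {k : X ≃ᵢ X} {x : X}
    (hmin : ∀ q, dist x (k x) ≤ dist q (k q)) (hpos : 0 < dist x (k x)) : IsHyperbolic k := by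
  set L := dist x (k x) with hL
  -- The lower bound is known for exponents that are powers of two. It descends from `2 ^ m` to `m ≤
  -- 2 ^ m` by the triangle inequality.
  have hpow : ∀ m : ℕ, dist x ((k ^ m) x) = m * L := by
    intro m
    refine le_antisymm (dist_pow_le k x m) ?_
    have h1 := hX.pow_two_mul_le_displacement hmin m x
    have hm : m ≤ 2 ^ m := Nat.lt_two_pow_self.le
    obtain ⟨j, hj⟩ := Nat.exists_eq_add_of_le hm
    have h2 := dist_triangle x ((k ^ m) x) ((k ^ 2 ^ m) x)
    have h3 : dist ((k ^ m) x) ((k ^ 2 ^ m) x) ≤ j * L := by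
      rw [hj, pow_add, IsometryEquiv.mul_apply, (k ^ m).dist_eq]
      exact dist_pow_le k x j
    have h4 : (2 : ℝ) ^ m = m + j := by exact_mod_cast hj
    rw [h4] at h1
    linarith
  have hzpow : ∀ i j : ℤ, i ≤ j → dist ((k ^ i) x) ((k ^ j) x) = (j - i) * L := by
    intro i j hij
    obtain ⟨m, rfl⟩ := Int.le.dest hij
    rw [zpow_add, IsometryEquiv.mul_apply, (k ^ i).dist_eq, zpow_natCast, hpow m]
    push_cast
    ring
  -- The axis is the concatenation of the translates of the segment from `x` to `k x`; `r t` is the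
  -- arc length within the current translate.
  set r : ℝ → ℝ := fun t => t - ⌊t / L⌋ * L with hr
  have hr0 : ∀ t, 0 ≤ r t := fun t => by
    have := (le_div_iff₀ hpos).1 (Int.floor_le (t / L))
    simp only [hr]
    linarith
  have hrL : ∀ t, r t ≤ L := fun t => by
    have := (div_lt_iff₀ hpos).1 (Int.lt_floor_add_one (t / L))
    simp only [hr]
    linarith
  set c : ℝ → X := fun t => (k ^ ⌊t / L⌋) (hX.geo x (k x) (r t)) with hc
  have hleft : ∀ t, dist ((k ^ ⌊t / L⌋) x) (c t) = r t := fun t => by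
    simp only [hc]
    rw [(k ^ ⌊t / L⌋).dist_eq, hX.dist_left_geo x (k x) (hr0 t) (hrL t)]
  have hright : ∀ t, dist (c t) ((k ^ (⌊t / L⌋ + 1)) x) = L - r t := fun t => by
    have := hX.dist_geo_geo x (k x) (hr0 t) (hrL t) dist_nonneg le_rfl
    rw [geo_dist, abs_sub_comm, abs_of_nonneg (sub_nonneg.2 (hrL t))] at this
    simp only [hc]
    rw [zpow_add_one, IsometryEquiv.mul_apply, (k ^ ⌊t / L⌋).dist_eq, this]
  -- The upper bound follows the concatenated path; the lower bound extends it to orbit points on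
  -- either side, whose distance is exact.
  have hlt : ∀ s t, s ≤ t → dist (c s) (c t) = t - s := by
    intro s t hst
    have hab : ⌊s / L⌋ ≤ ⌊t / L⌋ := Int.floor_le_floor (by gcongr)
    have l1 := hleft s
    have r2 := hright t
    have d1 := hzpow ⌊s / L⌋ (⌊t / L⌋ + 1) (by omega)
    have tr := dist_triangle4 ((k ^ ⌊s / L⌋) x) (c s) (c t) ((k ^ (⌊t / L⌋ + 1)) x)
    have rs : r s = s - ⌊s / L⌋ * L := rfl
    have rt : r t = t - ⌊t / L⌋ * L := rfl
    refine le_antisymm ?_ ?_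
    · rcases hab.eq_or_lt with h | h
      · have := hX.dist_geo_geo x (k x) (hr0 s) (hrL s) (hr0 t) (hrL t)
        simp only [hc]
        rw [← h, (k ^ ⌊s / L⌋).dist_eq, this, rs, rt, h]
        rw [abs_sub_comm, abs_of_nonneg] <;> linarith
      · have r1 := hright s
        have l2 := hleft t
        have d2 := hzpow (⌊s / L⌋ + 1) ⌊t / L⌋ (by omega)
        have tr' := dist_triangle4 (c s) ((k ^ (⌊s / L⌋ + 1)) x) ((k ^ ⌊t / L⌋) x) (c t)
        push_cast at d2
        linarith
    · push_cast at d1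
      linarith
  refine ⟨c, Isometry.of_dist_eq fun s t => ?_, L, hpos, fun t => ?_⟩
  · rw [Real.dist_eq]
    rcases le_total s t with h | h
    · rw [hlt s t h, abs_sub_comm, abs_of_nonneg (sub_nonneg.2 h)]
    · rw [dist_comm, hlt t s h, abs_of_nonneg (sub_nonneg.2 h)]
  · have e : ⌊(t + L) / L⌋ = 1 + ⌊t / L⌋ := by
      rw [add_div, div_self hpos.ne', Int.floor_add_one, add_comm]
    have e2 : r (t + L) = r t := by
      simp only [hr]
      rw [e]
      push_cast
      ring
    simp only [hc]
    rw [e2, e, zpow_add, zpow_one, IsometryEquiv.mul_apply]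

/-- The segments between points near `k ^ m p` and `k ^ (-m) p` pass near `p`, for large `m`. -/
def Contracting (hX : IsHadamardSpace X) (k : X ≃ᵢ X) (p : X) (N : ℝ) : Prop :=
  ∀ D : ℝ, ∃ m : ℕ, ∀ x y, dist x ((k ^ m) p) ≤ D → dist y ((k⁻¹ ^ m) p) ≤ D →
    ∃ l ∈ Icc (0 : ℝ) 1, dist p (hX.pt x y l) ≤ N

/-- The points `k ^ m q` and `k⁻¹ ^ m q` have the displacement of `q`, and the segment between them
meets the ball of radius `N` about `p`. By convexity of the displacement, its minimum on the ball is
global. -/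
theorem Contracting.exists_min [ProperSpace X] {k : X ≃ᵢ X} {p : X} {N : ℝ}
    (h : hX.Contracting k p N) (hN : 0 ≤ N) : ∃ x, ∀ q, dist x (k x) ≤ dist q (k q) := by
  obtain ⟨x, -, hx⟩ := (isCompact_closedBall p N).exists_isMinOn
    ⟨p, Metric.mem_closedBall_self hN⟩
    (f := fun q => dist q (k q)) (continuous_id.dist k.continuous).continuousOn
  refine ⟨x, fun q => ?_⟩
  obtain ⟨m, hm⟩ := h (dist q p)
  obtain ⟨l, hl, hd⟩ := hm ((k ^ m) q) ((k⁻¹ ^ m) q)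
    (by rw [(k ^ m).dist_eq]) (by rw [(k⁻¹ ^ m).dist_eq])
  refine (isMinOn_iff.1 hx _ (by rwa [Metric.mem_closedBall, dist_comm])).trans ?_
  have e1 : dist ((k ^ m) q) (k ((k ^ m) q)) = dist q (k q) := by
    rw [← IsometryEquiv.mul_apply k, ← pow_succ', pow_succ, IsometryEquiv.mul_apply,
      (k ^ m).dist_eq]
  have e2 : dist ((k⁻¹ ^ m) q) (k ((k⁻¹ ^ m) q)) = dist q (k q) := by
    rw [← IsometryEquiv.mul_apply k, ((Commute.refl k).inv_right.pow_right m).eq,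
      IsometryEquiv.mul_apply, (k⁻¹ ^ m).dist_eq]
  have := hX.dist_pt_pt_le ((k ^ m) q) ((k⁻¹ ^ m) q) (k ((k ^ m) q)) (k ((k⁻¹ ^ m) q)) hl
  rw [← hX.map_pt k _ _ hl, e1, e2] at this
  refine this.trans (le_of_eq ?_)
  ring

theorem plane_dist_horizontal (s t h : ℝ) : dist (!₂[s, h] : Plane) !₂[t, h] = |s - t| := by
  rw [EuclideanSpace.dist_eq]
  simp [Fin.sum_univ_two, Real.dist_eq, Real.sqrt_sq_eq_abs]

theorem plane_le_dist (s t h : ℝ) : h ≤ dist (!₂[s, 0] : Plane) !₂[t, h] := by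
  rw [EuclideanSpace.dist_eq]
  refine Real.le_sqrt_of_sq_le ?_
  simp [Fin.sum_univ_two, Real.dist_eq]
  positivity

theorem plane_dist_vertical (s h : ℝ) : dist (!₂[s, h] : Plane) !₂[s, 0] = |h| := by
  rw [EuclideanSpace.dist_eq]
  simp [Fin.sum_univ_two, Real.sqrt_sq_eq_abs]

theorem pow_apply_of_translation {k : X ≃ᵢ X} {c : ℝ → X} {l : ℝ} (h : ∀ t, k (c t) = c (t + l)) (m : ℕ)
    (t : ℝ) : (k ^ m) (c t) = c (t + m * l) := by
  induction m generalizing t with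
  | zero => simp
  | succ m ih =>
    rw [pow_succ, IsometryEquiv.mul_apply, h, ih]
    push_cast
    congr 1
    ring

/-- Each horizontal line of the half plane stays at bounded distance from the axis, so it must pass
within `N` of `p`. Lines at heights `0` and `2 * N + 1` cannot both do so. -/
theorem Contracting.not_boundsFlatHalfPlane {k : X ≃ᵢ X} {p : X} {N : ℝ}
    (h : hX.Contracting k p N) (hN : 0 ≤ N) {c : ℝ → X} (hc : IsAxis k c) :
    ¬ BoundsFlatHalfPlane c := by
  rintro ⟨f, hf, hcf⟩
  obtain ⟨-, L, -, hL⟩ := hc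
  have hL' : ∀ t, k⁻¹ (c t) = c (t + -L) := by
    intro t
    have := hL (t + -L)
    rw [neg_add_cancel_right] at this
    rw [← this, IsometryEquiv.inv_apply_self]
  have near : ∀ a : ℝ, 0 ≤ a → ∃ s : ℝ, dist p (f !₂[s, a]) ≤ N := by
    intro a ha
    have hfd : ∀ u v : Plane, u 1 = a → v 1 = a → dist (f u) (f v) = dist u v := fun u v hu hv =>
      hf u v (by rw [hu]; exact ha) (by rw [hv]; exact ha)
    obtain ⟨m, hm⟩ := h (a + dist (c 0) p)
    have hver : ∀ s, dist (f !₂[s, a]) (c s) = a := fun s => by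
      rw [hcf, hf _ _ (by simpa using ha) (by simp), plane_dist_vertical, abs_of_nonneg ha]
    obtain ⟨l, hl, hd⟩ := hm (f !₂[m * L, a]) (f !₂[-(m * L), a])
      ((dist_triangle _ (c (m * L)) _).trans (by
        have e := pow_apply_of_translation hL m 0
        rw [zero_add] at e
        rw [hver, ← e, (k ^ m).dist_eq]))
      ((dist_triangle _ (c (-(m * L))) _).trans (by
        have e := pow_apply_of_translation hL' m 0
        rw [zero_add, mul_neg] at e
        rw [hver, ← e, (k⁻¹ ^ m).dist_eq]))
    refine ⟨(1 - 2 * l) * (m * L), ?_⟩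
    rw [hX.eq_pt (z := f !₂[(1 - 2 * l) * (m * L), a]) hl]
    · exact hd
    · rw [hfd _ _ (by simp) (by simp), hfd _ _ (by simp) (by simp), plane_dist_horizontal,
        plane_dist_horizontal, ← abs_of_nonneg hl.1, ← abs_mul, abs_of_nonneg hl.1]
      exact le_of_eq (congrArg _ (by ring))
    · have hl' : 0 ≤ 1 - l := sub_nonneg.2 hl.2
      rw [hfd _ _ (by simp) (by simp), hfd _ _ (by simp) (by simp), plane_dist_horizontal,
        plane_dist_horizontal, ← abs_of_nonneg hl', ← abs_mul]
      exact le_of_eq (congrArg _ (by ring))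
  obtain ⟨s, hs⟩ := near 0 le_rfl
  obtain ⟨t, ht⟩ := near (2 * N + 1) (by positivity)
  have h1 := plane_le_dist s t (2 * N + 1)
  rw [← hf _ _ (by simp) (by simpa using (by positivity : 0 ≤ 2 * N + 1))] at h1
  linarith [dist_triangle_left (f !₂[s, 0]) (f !₂[t, 2 * N + 1]) p]

theorem exists_isRankOne [ProperSpace X] (hX : IsHadamardSpace X) {ω : Ultrafilter ℕ} {p : X}
    {k : ℕ → X ≃ᵢ X} {c₁ c₂ : Ray X} (h₁ : hX.Conv ω p (fun i => k i p) c₁)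
    (h₂ : hX.Conv ω p (fun i => (k i)⁻¹ p) c₂) (hJ : ¬ Joined c₁ c₂) : ∃ i, IsRankOne (k i) := by
  obtain ⟨N, hN, ht⟩ := hX.exists_tight h₁.source h₂.source hJ
  have hN0 : 0 ≤ N := zero_le_one.trans hN
  have third : (0 : ℝ) < 1 / 3 := by norm_num
  have ev₁ := (tendsto_iff_dist_tendsto_zero.1 (h₁.geo_tendsto N hN0)).eventually_lt_const third
  have ev₂ := (tendsto_iff_dist_tendsto_zero.1 (h₂.geo_tendsto N hN0)).eventually_lt_const third
  obtain ⟨i, hi₁, hi₂, hT₁, hT₂, n₁, n₂⟩ := (ev₁.and (ev₂.and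
    ((h₁.dist_tendsto.eventually_ge_atTop (6 * N ^ 2 + 2 * N + 1)).and
    ((h₂.dist_tendsto.eventually_ge_atTop (6 * N ^ 2 + 2 * N + 1)).and
    ((h₁.eventually_near hN0).and (h₂.eventually_near hN0)))))).exists
  refine ⟨i, ?_⟩
  generalize k i = g at *
  have hcon : hX.Contracting g p N := by
    intro D
    obtain ⟨M₁, hM₁⟩ := ht.exists_forall_near hN hT₁ hi₁.le n₂ D
    obtain ⟨M₂, hM₂⟩ := ht.symm.exists_forall_near hN hT₂ hi₂.le (by rwa [inv_inv]) D
    exact ⟨max M₁ M₂, fun x y hx hy =>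
      ht x y (hM₁ _ (le_max_left _ _) x hx) (hM₂ _ (le_max_right _ _) y hy)⟩
  obtain ⟨x, hx⟩ := hcon.exists_min hN0
  refine ⟨hX.isHyperbolic_of_min hx ?_, fun c hc => hcon.not_boundsFlatHalfPlane hN0 hc⟩
  -- A fixed point would bound the orbit of `p`, whereas ping-pong makes it unbounded.
  by_contra hc
  have hfix : dist x (g x) = 0 := le_antisymm (not_lt.1 hc) dist_nonneg
  obtain ⟨m, hm⟩ := exists_nat_ge (2 * dist p x)
  have h3 := (ht.pow_near hN hT₁ hi₁.le n₂ m).2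
  have h4 := dist_pow_le g x (m + 1)
  rw [hfix, mul_zero] at h4
  have h5 := dist_triangle4 p x ((g ^ (m + 1)) x) ((g ^ (m + 1)) p)
  rw [(g ^ (m + 1)).dist_eq, dist_comm x p] at h5
  nlinarith [sq_nonneg N]

end IsHadamardSpace

end CatZero

/-! ### The limit set and the bound on its diameter. -/

namespace CatZero

/-- Since `dist p ((g i)⁻¹ p) = dist p (g i p)`, the inverse orbit points also run to infinity and
converge along the ultrafilter. -/
theorem exists_conv_of_mem_limitSet {X : Type*} [MetricSpace X] [ProperSpace X]
    (hX : IsHadamardSpace X) {Γ : Subgroup (X ≃ᵢ X)} {ξ : Boundary X} (hξ : ξ ∈ limitSet Γ)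
    (p : X) : ∃ (g : ℕ → X ≃ᵢ X) (c c' : Ray X), (∀ i, g i ∈ Γ) ∧
      hX.Conv (hyperfilter ℕ) p (fun i => g i p) c ∧
      hX.Conv (hyperfilter ℕ) p (fun i => (g i)⁻¹ p) c' ∧
      (Quotient.mk (raySetoid X) c : Boundary X) = ξ := by
  obtain ⟨g, hg, x, hx⟩ := hξ
  obtain ⟨c, hc, hcξ⟩ := hX.exists_conv_of_convergesTo (hyperfilter ℕ)
    Nat.hyperfilter_le_atTop hx p (y := fun i => g i p) (K := dist p x)
    fun i => ((g i).dist_eq p x).le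
  have hd : ∀ i, dist p ((g i)⁻¹ p) = dist p (g i p) := fun i => by
    rw [← (g i).dist_eq, IsometryEquiv.apply_inv_self, dist_comm]
  obtain ⟨c', hc'⟩ := hX.exists_conv (hyperfilter ℕ) p (fun i => (g i)⁻¹ p)
    (by simpa only [hd] using hc.dist_tendsto)
  exact ⟨g, c, c', hg, hc, hc', hcξ.2⟩

end CatZero

theorem corollary2p14 {X : Type*} [MetricSpace X] [LocallyCompactSpace X]
    (hX : CatZero.IsHadamardSpace X) (Γ : Subgroup (X ≃ᵢ X))
    (hΓ : ∀ g ∈ Γ, ¬ CatZero.IsRankOne g) :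
    CatZero.titsDiam (CatZero.limitSet Γ) ≤ ENNReal.ofReal (2 * Real.pi) := by
  have := hX.properSpace
  refine iSup₂_le fun ξ hξ => iSup₂_le fun η hη => ?_
  obtain ⟨p⟩ : Nonempty X := ⟨hξ.choose_spec.2.choose⟩
  obtain ⟨g, c, c', hg, hc, hc', rfl⟩ := CatZero.exists_conv_of_mem_limitSet hX hξ p
  obtain ⟨h, d, d', hh, hd, hd', rfl⟩ := CatZero.exists_conv_of_mem_limitSet hX hη p
  have no : ∀ (k : ℕ → X ≃ᵢ X) (e e' : CatZero.Ray X), (∀ i, k i ∈ Γ) →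
      hX.Conv (hyperfilter ℕ) p (fun i => k i p) e →
      hX.Conv (hyperfilter ℕ) p (fun i => (k i)⁻¹ p) e' → CatZero.Joined e e' := by
    intro k e e' hk he he'
    by_contra hJ
    obtain ⟨i, hi⟩ := hX.exists_isRankOne he he' hJ
    exact hΓ _ (hk i) hi
  have j₁ : CatZero.Joined c c' := no g c c' hg hc hc'
  have j₂ : CatZero.Joined d' d :=
    no (fun i => (h i)⁻¹) d' d (fun i => Γ.inv_mem (hh i)) hd' (by simpa only [inv_inv] using hd)
  by_cases j₃ : CatZero.Joined c' d
  · exact CatZero.titsDist_le_two_pi j₁ j₃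
  -- Here `c'` and `d` are tight, so the products `g i * h i` join `c` to `d'`.
  refine CatZero.titsDist_le_two_pi (no (fun i => g i * h i) c d' (fun i => Γ.mul_mem (hg i) (hh i))
    ?_ ?_) j₂
  all_goals obtain ⟨N, hN, ht⟩ := hX.exists_tight hc'.source hd.source j₃
  · exact hc.mul (zero_le_one.trans hN) hc' hd ht
  · simp only [mul_inv_rev]
    exact hd'.mul (zero_le_one.trans hN) (by simpa only [inv_inv] using hd) hc' ht.symm
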